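/- Let $K$ be a field of characteristic $0$ (for example $\mathbb{R}$ or $\mathbb{Q}$). A composition is a finite (possibly empty) sequence $\alpha=(a_1,\dots,a_k)$ of positive integers, of size $|\alpha|=a_1+\cdots+a_k$; $\mathrm{Comp}(n)$ is the set of compositions of size $n$, and for $\alpha=(a_1,\dots,a_k),\beta\in\mathrm{Comp}(n)$ we write $\alpha\le\beta$ if $\beta$ is a concatenation $\beta=\beta_1\cdots\beta_k$ of compositions with $|\beta_i|=a_i$ (the $\beta_i$ are then unique). A nonempty composition is Lyndon if it is lexicographically strictly smaller than each of its cyclic rearrangements $(a_{i+1},\dots,a_k,a_1,\dots,a_i)$, $0<i<k$; let $\mathcal{L}$ be the set of Lyndon compositions. Let $\mathcal{Q}_K$ be the graded Hopf algebra of quasisymmetric functions over $K$: its basis is formed by the monomial quasisymmetric functions $M_\alpha=\sum_{i_1<\cdots<i_k}x_{i_1}^{a_1}\cdots x_{i_k}^{a_k}$, its product is that of power series, its coproduct is $\Delta(M_\alpha)=\sum_{\alpha=\beta\cdot\gamma}M_\beta\otimes M_\gamma$ (sum over all ways of writing $\alpha$ as a concatenation), its counit satisfies $\varepsilon(M_\alpha)=\delta_{\alpha,()}$,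 and its component of degree $n$ is spanned by the $M_\alpha$ with $\alpha\in\mathrm{Comp}(n)$. (i) For every composition $\beta$ there is a unique polynomial $A(\beta)$ with rational coefficients in commuting variables $u_\alpha$, $\alpha\in\mathcal{L}$, that becomes $M_\beta\in\mathcal{Q}_{\mathbb{Q}}$ when every $u_\alpha$ is replaced by $M_\alpha$ (the Lyndon expansion of $M_\beta$). For $\alpha,\beta\in\mathrm{Comp}(n)$ put $A_n(\beta,\alpha)=A(\beta_1)\cdots A(\beta_k)$ if $\alpha=(a_1,\dots,a_k)\le\beta$ and $\beta=\beta_1\cdots\beta_k$ with $|\beta_i|=a_i$, and $A_n(\beta,\alpha)=0$ if $\alpha\not\le\beta$; in particular $A_0=(1)$. (ii) For any assignment of values in $K$ to the variables $u_\alpha$, $\alpha\in\mathcal{L}$, the $K$-linear operator $\Phi$ on $\mathcal{Q}_K$ defined by $$\Phi(M_\beta)=\sum_{\alpha\in\mathrm{Comp}(n),\ \alpha\le\beta}A_n(\beta,\alpha)\,M_\alpha\qquad\text{for all } n\ge 0 \text{ and } \beta\in\mathrm{Comp}(n)\qquad(*)$$ is an endomorphism of the graded Hopf algebra $\mathcal{Q}_K$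 (a degree-preserving Hopf algebra endomorphism). (iii) Conversely, every endomorphism of the graded Hopf algebra $\mathcal{Q}_K$ has the form $(*)$ for some assignment of values in $K$ to the variables $u_\alpha$. -/

import Mathlib

open scoped TensorProduct

noncomputable section

namespace QuasiSym

/-! ### Compositions -/

/-- A composition is a finite (possibly empty) sequence of positive integers.
Concatenation is `++`, the number of parts is `List.length`. -/
abbrev Comp : Type := List ℕ+

/-- The size `|α|`: the sum of the parts. -/
def size (α : Comp) : ℕ := (α.map (fun a : ℕ+ => (a : ℕ))).sum

@[simp] theorem size_nil : size [] = 0 := rfl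

@[simp] theorem size_cons (a : ℕ+) (α : Comp) : size (a :: α) = (a : ℕ) + size α := by
  simp [size]

@[simp] theorem size_append (α β : Comp) : size (α ++ β) = size α + size β := by
  simp [size]

theorem size_flatten (L : List Comp) : size L.flatten = (L.map size).sum := by
  induction L with
  | nil => rfl
  | cons a L ih => simp [ih]

/-- The composition in the sense of Mathlib, as a list of positive integers. -/
def ofComposition {n : ℕ} (c : Composition n) : Comp := c.blocks.map Nat.toPNat'

/-- The finite set `Comp(n)` of compositions of `n`. -/
def compsOf (n : ℕ) : Finset Comp :=
  Finset.univ.image (fun c : Composition n => ofComposition c)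

@[simp] theorem mem_compsOf {n : ℕ} {α : Comp} : α ∈ compsOf n ↔ size α = n := by
  simp only [compsOf, Finset.mem_image, Finset.mem_univ, true_and, ofComposition]
  constructor
  · rintro ⟨c, rfl⟩
    rw [size, List.map_map]
    conv_rhs => rw [← c.blocks_sum]
    congr 1
    conv_rhs => rw [← List.map_id c.blocks]
    refine List.map_congr_left fun i hi => ?_
    simpa using PNat.toPNat'_coe (c.blocks_pos hi)
  · intro h
    refine ⟨⟨α.map (fun a : ℕ+ => (a : ℕ)), ?_, h⟩, ?_⟩
    · intro i hi
      obtain ⟨a, -, rfl⟩ := List.mem_map.1 hi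
      exact a.pos
    · simp [List.map_map, Function.comp_def]

/-- `Cuts L β α` says that the list `L = (β₁, …, βₖ)` of compositions satisfies
`β = β₁ ⋯ βₖ` (concatenation) and `α = (|β₁|, …, |βₖ|)`. -/
def Cuts (L : List Comp) (β α : Comp) : Prop :=
  L.flatten = β ∧ L.map size = α.map (fun a : ℕ+ => (a : ℕ))

/-- The refinement order `α ≤ β`: the composition `β` is a refinement of `α`. -/
def Refines (β α : Comp) : Prop := ∃ L : List Comp, Cuts L β α

theorem Cuts.unique {L L' : List Comp} {β α : Comp} (h : Cuts L β α) (h' : Cuts L' β α) :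
    L = L' := by
  induction α generalizing L L' β with
  | nil =>
    have h1 : L = [] := by simpa using h.2
    have h2 : L' = [] := by simpa using h'.2
    rw [h1, h2]
  | cons a α ih =>
    have pre : ∀ (γ γ' δ δ' : Comp), γ ++ δ = γ' ++ δ' → size γ = size γ' → γ = γ' := by
      intro γ
      induction γ with
      | nil =>
        intro γ' δ δ' _ hs
        cases γ' with
        | nil => rfl
        | cons b γ' =>
          simp only [size_nil, size_cons] at hs
          have := b.pos
          omega
      | cons b γ ihγ =>
        intro γ' δ δ' he hs
        cases γ' with
        | nil =>
          simp only [size_nil, size_cons] at hs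
          have := b.pos
          omega
        | cons c γ' =>
          simp only [List.cons_append, List.cons.injEq] at he
          obtain ⟨rfl, he⟩ := he
          simp only [size_cons] at hs
          rw [ihγ γ' δ δ' he (by omega)]
    cases L with
    | nil => simp [Cuts] at h
    | cons γ L =>
      cases L' with
      | nil => simp [Cuts] at h'
      | cons γ' L' =>
        obtain ⟨h1, h2⟩ := h
        obtain ⟨h1', h2'⟩ := h'
        simp only [List.map_cons, List.cons.injEq] at h2 h2'
        simp only [List.flatten_cons] at h1 h1'
        have hγ : γ = γ' := pre γ γ' L.flatten L'.flatten (h1.trans h1'.symm)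
          (h2.1.trans h2'.1.symm)
        subst hγ
        have hfl : L.flatten = L'.flatten := List.append_cancel_left (h1.trans h1'.symm)
        rw [ih (β := L.flatten) ⟨rfl, h2.2⟩ ⟨hfl.symm, h2'.2⟩]

/-- A composition is Lyndon if it is nonempty and lexicographically smaller than all of its
nontrivial cyclic rearrangements (`<` on lists is the lexicographic order). -/
def IsLyndon (α : Comp) : Prop :=
  α ≠ [] ∧ ∀ i, 0 < i → i < α.length → α < α.rotate i

/-- The set of Lyndon compositions. -/
abbrev Lyndon : Type := {α : Comp // IsLyndon α}

/-! ### Monomial quasisymmetric functions -/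

/-- The sequence of nonzero exponents of the monomial `x ^ d`, read in increasing order of the
variables. (`Nat.toPNat'` turns a nonzero natural number into a positive natural number.) -/
def shape (d : ℕ →₀ ℕ) : Comp := (d.support.sort (· ≤ ·)).map (fun i => (d i).toPNat')

/-- The monomial quasisymmetric function
`M_α = ∑_{i₁ < ⋯ < iₖ} x_{i₁} ^ a₁ ⋯ x_{iₖ} ^ aₖ` as a formal power series in the
variables `x_i`, `i : ℕ`: the coefficient of a monomial is `1` if its nonzero exponents, in
order, are `a₁, …, aₖ`, and `0` otherwise. -/
def monomialSeries (R : Type*) [CommRing R] (α : Comp) : MvPowerSeries ℕ R :=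
  fun d => if shape d = α then 1 else 0

theorem coeff_monomialSeries {R : Type*} [CommRing R] (α : Comp) (d : ℕ →₀ ℕ) :
    MvPowerSeries.coeff d (monomialSeries R α) = if shape d = α then 1 else 0 := rfl

theorem shape_embDomain (f : ℕ ↪o ℕ) (d : ℕ →₀ ℕ) :
    shape (d.embDomain f.toEmbedding) = shape d := by
  unfold shape
  rw [Finsupp.support_embDomain, ← Finset.map_sort f.toEmbedding d.support (· ≤ ·) (· ≤ ·)
    (fun a _ b _ => (f.le_iff_le).symm), List.map_map]
  refine List.map_congr_left fun i _ => ?_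
  simp only [Function.comp_apply]
  rw [Finsupp.embDomain_apply_self]

/-- The exponent vector of `x₀ ^ a₁ x₁ ^ a₂ ⋯`. -/
def packed (α : Comp) : ℕ →₀ ℕ :=
  Finsupp.onFinset (Finset.range α.length)
    (fun i => if h : i < α.length then (α[i] : ℕ) else 0)
    (by intro i hi; by_contra h; simp at h; simp [h] at hi)

theorem packed_apply (α : Comp) (i : ℕ) :
    packed α i = if h : i < α.length then (α[i] : ℕ) else 0 := rfl

theorem support_packed (α : Comp) : (packed α).support = Finset.range α.length := by
  ext i
  by_cases h : i < α.length <;> simp [packed_apply, h]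

theorem shape_packed (α : Comp) : shape (packed α) = α := by
  unfold shape
  rw [support_packed, Finset.sort_range]
  apply List.ext_getElem
  · simp
  · intro i h1 h2
    simp [packed_apply, h2]

theorem exists_embDomain_packed (d : ℕ →₀ ℕ) :
    ∃ f : ℕ ↪o ℕ, d = (packed (shape d)).embDomain f.toEmbedding := by
  set s := d.support with hs
  have hlen : (shape d).length = s.card := by simp [shape, hs]
  let g : ℕ → ℕ := fun j =>
    if h : j < s.card then s.orderEmbOfFin rfl ⟨j, h⟩ else s.sup id + 1 + j
  have hg : StrictMono g := by
    intro a b hab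
    by_cases hb : b < s.card
    · have ha : a < s.card := hab.trans hb
      simp only [g, ha, hb, dif_pos]
      exact (s.orderEmbOfFin rfl).strictMono (by simpa using hab)
    · by_cases ha : a < s.card
      · simp only [g, ha, hb, dif_pos, dif_neg, not_false_eq_true]
        have : s.orderEmbOfFin rfl ⟨a, ha⟩ ≤ s.sup id :=
          Finset.le_sup (f := id) (s.orderEmbOfFin_mem rfl _)
        omega
      · simp only [g, ha, hb, dif_neg, not_false_eq_true]
        omega
  refine ⟨OrderEmbedding.ofStrictMono g hg, ?_⟩
  ext n
  by_cases hn : ∃ j, g j = n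
  · obtain ⟨j, rfl⟩ := hn
    have e : (packed (shape d)).embDomain (OrderEmbedding.ofStrictMono g hg).toEmbedding (g j)
      = packed (shape d) j :=
        Finsupp.embDomain_apply_self (OrderEmbedding.ofStrictMono g hg).toEmbedding _ j
    rw [e, packed_apply]
    by_cases hj : j < s.card
    · have hm : s.orderEmbOfFin rfl ⟨j, hj⟩ ∈ s := s.orderEmbOfFin_mem rfl _
      have hgj : g j = s.orderEmbOfFin rfl ⟨j, hj⟩ := by simp [g, hj]
      rw [dif_pos (by rw [hlen]; exact hj)]
      have hpos : 0 < d (g j) := by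
        rw [hgj]; exact Nat.pos_of_ne_zero (Finsupp.mem_support_iff.1 hm)
      simp only [shape, List.getElem_map]
      have : (d.support.sort (· ≤ ·))[j]'(by simpa using hj) = g j := by
        rw [hgj, Finset.orderEmbOfFin_apply]
        rfl
      rw [this, PNat.toPNat'_coe hpos]
    · rw [dif_neg (by rw [hlen]; exact hj)]
      by_contra h
      have hm : g j ∈ s := Finsupp.mem_support_iff.2 h
      have : g j ≤ s.sup id := Finset.le_sup (f := id) hm
      simp only [g, hj, dif_neg, not_false_eq_true] at this
      omega
  · rw [Finsupp.embDomain_of_notMem_range]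
    · by_contra h
      have hm : n ∈ s := Finsupp.mem_support_iff.2 h
      have : n ∈ Set.range (s.orderEmbOfFin rfl) := by
        rw [Finset.range_orderEmbOfFin]; exact hm
      obtain ⟨⟨j, hj⟩, hjn⟩ := this
      exact hn ⟨j, by simp only [g, hj, dif_pos]; exact hjn⟩
    · rintro ⟨j, hj⟩
      exact hn ⟨j, hj⟩

theorem size_shape (d : ℕ →₀ ℕ) : size (shape d) = d.degree := by
  rw [size, shape, List.map_map, Finsupp.degree_apply]
  have h : d.support.sum d = ((d.support.sort (· ≤ ·)).map d).sum := by
    rw [Finset.sum_eq_multiset_sum, ← Finset.sort_eq d.support (· ≤ ·), Multiset.map_coe,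
      Multiset.sum_coe]
  rw [h]
  congr 1
  refine List.map_congr_left fun i hi => ?_
  have : i ∈ d.support := by simpa using hi
  simpa using PNat.toPNat'_coe (Nat.pos_of_ne_zero (Finsupp.mem_support_iff.1 this))

section

variable {R : Type*} [CommRing R]

theorem antidiagonal_embDomain (f : ℕ ↪o ℕ) (d : ℕ →₀ ℕ) :
    Finset.HasAntidiagonal.antidiagonal (d.embDomain f.toEmbedding) =
      (Finset.HasAntidiagonal.antidiagonal d).image
        (fun p => (p.1.embDomain f.toEmbedding, p.2.embDomain f.toEmbedding)) := by
  ext ⟨a, b⟩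
  simp only [Finset.HasAntidiagonal.mem_antidiagonal, Finset.mem_image, Prod.mk.injEq, Prod.exists]
  constructor
  · intro h
    have key : ∀ c e : ℕ →₀ ℕ, c + e = d.embDomain f.toEmbedding →
        (c.comapDomain f f.injective.injOn).embDomain f.toEmbedding = c := by
      intro c e hce
      ext n
      by_cases hn : n ∈ Set.range f.toEmbedding
      · obtain ⟨j, rfl⟩ := hn
        rw [Finsupp.embDomain_apply_self, Finsupp.comapDomain_apply]
        rfl
      · rw [Finsupp.embDomain_of_notMem_range _ _ _ hn]
        have := DFunLike.congr_fun hce n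
        rw [Finsupp.embDomain_of_notMem_range _ _ _ hn, Finsupp.add_apply] at this
        omega
    refine ⟨a.comapDomain f f.injective.injOn, b.comapDomain f f.injective.injOn, ?_,
      key a b h, key b a (by rw [add_comm]; exact h)⟩
    ext n
    have := DFunLike.congr_fun h (f n)
    have e := Finsupp.embDomain_apply_self f.toEmbedding d n
    simp only [Finsupp.add_apply, Finsupp.comapDomain_apply]
    simp only [Finsupp.add_apply] at this
    exact this.trans e
  · rintro ⟨c, e, rfl, rfl, rfl⟩
    simp only [Finsupp.embDomain_eq_mapDomain, Finsupp.mapDomain_add]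

theorem mem_span_monomialSeries {F : MvPowerSeries ℕ R} :
    F ∈ Submodule.span R (Set.range (monomialSeries R)) ↔
      (∀ d e, shape d = shape e → MvPowerSeries.coeff d F = MvPowerSeries.coeff e F) ∧
      ∃ N, ∀ d, N < size (shape d) → MvPowerSeries.coeff d F = 0 := by
  constructor
  · intro h
    induction h using Submodule.span_induction with
    | mem x hx =>
      obtain ⟨α, rfl⟩ := hx
      refine ⟨fun d e h => by simp [coeff_monomialSeries, h], size α, fun d hd => ?_⟩
      rw [coeff_monomialSeries, if_neg]
      rintro rfl
      exact lt_irrefl _ hd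
    | zero => exact ⟨fun d e h => by simp, 0, fun d hd => by simp⟩
    | add x y _ _ hx hy =>
      obtain ⟨hx, N, hN⟩ := hx
      obtain ⟨hy, N', hN'⟩ := hy
      refine ⟨fun d e h => by rw [map_add, map_add, hx d e h, hy d e h], max N N',
        fun d hd => ?_⟩
      rw [map_add, hN d (lt_of_le_of_lt (le_max_left _ _) hd),
        hN' d (lt_of_le_of_lt (le_max_right _ _) hd), add_zero]
    | smul r x _ hx =>
      obtain ⟨hx, N, hN⟩ := hx
      refine ⟨fun d e h => ?_, N, fun d hd => ?_⟩
      · rw [map_smul, map_smul, hx d e h]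
      · rw [map_smul, hN d hd, smul_zero]
  · rintro ⟨h, N, hN⟩
    have : F = ∑ α ∈ (Finset.range (N + 1)).biUnion compsOf,
        MvPowerSeries.coeff (packed α) F • monomialSeries R α := by
      ext d
      rw [map_sum]
      simp only [map_smul, coeff_monomialSeries, smul_eq_mul, mul_ite, mul_one, mul_zero]
      rw [Finset.sum_ite_eq]
      by_cases hd : size (shape d) ≤ N
      · rw [if_pos]
        · exact h _ _ (shape_packed _).symm
        · simp only [Finset.mem_biUnion, Finset.mem_range, mem_compsOf]
          exact ⟨_, Nat.lt_succ_of_le hd, rfl⟩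
      · rw [if_neg]
        · exact hN d (not_le.1 hd)
        · simp only [Finset.mem_biUnion, Finset.mem_range, mem_compsOf]
          rintro ⟨a, ha, rfl⟩
          omega
    rw [this]
    exact Submodule.sum_mem _ fun α _ => Submodule.smul_mem _ _ (Submodule.subset_span ⟨α, rfl⟩)

variable (R) in
/-- The algebra of quasisymmetric functions over `R`, inside the ring of formal power series in
`x₀, x₁, x₂, …`: the set of linear combinations of the monomial quasisymmetric functions, with
the ordinary product of power series. -/
def qsymSubalgebra : Subalgebra R (MvPowerSeries ℕ R) :=
  (Submodule.span R (Set.range (monomialSeries R))).toSubalgebra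
    (by
      refine mem_span_monomialSeries.2 ⟨fun d e h => ?_, 0, fun d hd => ?_⟩
      · have : d = 0 ↔ e = 0 := by
          rw [← Finsupp.degree_eq_zero_iff d, ← Finsupp.degree_eq_zero_iff e, ← size_shape,
            ← size_shape, h]
        simp [MvPowerSeries.coeff_one, this]
      · rw [size_shape] at hd
        rw [MvPowerSeries.coeff_one, if_neg]
        rintro rfl
        simp at hd)
    (by
      intro F G hF hG
      obtain ⟨hF, N, hN⟩ := mem_span_monomialSeries.1 hF
      obtain ⟨hG, N', hN'⟩ := mem_span_monomialSeries.1 hG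
      refine mem_span_monomialSeries.2 ⟨?_, N + N', fun d hd => ?_⟩
      · have key : ∀ d, MvPowerSeries.coeff d (F * G) =
            MvPowerSeries.coeff (packed (shape d)) (F * G) := by
          intro d
          obtain ⟨f, hf⟩ := exists_embDomain_packed d
          conv_lhs => rw [hf]
          rw [MvPowerSeries.coeff_mul, MvPowerSeries.coeff_mul, antidiagonal_embDomain,
            Finset.sum_image]
          · refine Finset.sum_congr rfl fun p _ => ?_
            rw [hF _ p.1 (shape_embDomain f p.1), hG _ p.2 (shape_embDomain f p.2)]
          · intro p _ q _ hpq
            simp only [Prod.mk.injEq, Finsupp.embDomain_inj] at hpq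
            exact Prod.ext hpq.1 hpq.2
        intro d e h
        rw [key d, key e, h]
      · rw [MvPowerSeries.coeff_mul]
        refine Finset.sum_eq_zero fun p hp => ?_
        rw [Finset.HasAntidiagonal.mem_antidiagonal] at hp
        rw [size_shape, ← hp, map_add] at hd
        by_cases h : N < p.1.degree
        · rw [hN _ (by rwa [size_shape]), zero_mul]
        · rw [hN' _ (by rw [size_shape]; omega), mul_zero])

variable (R) in
/-- The type of quasisymmetric functions with coefficients in `R`. -/
abbrev QSym : Type _ := qsymSubalgebra R

variable (R) in
/-- The monomial quasisymmetric function `M_α` as an element of `QSym R`. -/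
def M (α : Comp) : QSym R := ⟨monomialSeries R α, Submodule.subset_span ⟨α, rfl⟩⟩

variable (R) in
theorem coeff_M (α : Comp) (d : ℕ →₀ ℕ) :
    MvPowerSeries.coeff d (M R α : MvPowerSeries ℕ R) = if shape d = α then 1 else 0 := rfl

theorem coeff_eq_of_shape (F : QSym R) {d e : ℕ →₀ ℕ} (h : shape d = shape e) :
    MvPowerSeries.coeff d (F : MvPowerSeries ℕ R) = MvPowerSeries.coeff e F.1 :=
  (mem_span_monomialSeries.1 F.2).1 d e h

variable (R) in
theorem linearIndependent_M : LinearIndependent R (M R) := by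
  rw [linearIndependent_iff']
  intro s g h α hα
  have h1 := congrArg (fun F : QSym R => MvPowerSeries.coeff (packed α) F.1) h
  simpa [coeff_M, shape_packed, hα] using h1

variable (R) in
theorem span_M : ⊤ ≤ Submodule.span R (Set.range (M R)) := by
  rintro ⟨F, hF⟩ -
  have hF' : F ∈ Submodule.span R (Set.range (monomialSeries R)) := hF
  induction hF' using Submodule.span_induction with
  | mem x hx =>
    obtain ⟨α, rfl⟩ := hx
    exact Submodule.subset_span ⟨α, rfl⟩
  | zero => exact Submodule.zero_mem _
  | add x y hx hy ihx ihy => exact Submodule.add_mem _ (ihx hx) (ihy hy)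
  | smul r x hx ihx => exact Submodule.smul_mem _ r (ihx hx)

variable (R) in
/-- The monomial basis of `QSym R`. -/
def monomialBasis : Module.Basis Comp R (QSym R) :=
  Module.Basis.mk (linearIndependent_M R) (span_M R)

@[simp] theorem monomialBasis_apply (α : Comp) : monomialBasis R α = M R α := by
  simp [monomialBasis]

end

/-! ### The Hopf algebra structure -/

section

variable {R : Type*} [CommRing R]

open Coalgebra

/-- The coproduct `Δ(M_α) = ∑_{α = β ⋅ γ} M_β ⊗ M_γ` (deconcatenation) and the counit
`ε(M_α) = δ_{α, ∅}`. -/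
instance : CoalgebraStruct R (QSym R) where
  comul := (monomialBasis R).constr R fun α =>
    ∑ i ∈ Finset.range (α.length + 1), M R (α.take i) ⊗ₜ[R] M R (α.drop i)
  counit := (monomialBasis R).constr R fun α => if α = [] then 1 else 0

theorem comul_M (α : Comp) : comul (R := R) (M R α) =
    ∑ i ∈ Finset.range (α.length + 1), M R (α.take i) ⊗ₜ[R] M R (α.drop i) := by
  rw [← monomialBasis_apply]
  exact Module.Basis.constr_basis _ _ _ _

theorem counit_M (α : Comp) : counit (R := R) (M R α) = if α = [] then 1 else 0 := by
  rw [← monomialBasis_apply]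
  exact Module.Basis.constr_basis _ _ _ _

instance : Coalgebra R (QSym R) where
  coassoc := by
    refine (monomialBasis R).ext fun α => ?_
    simp only [monomialBasis_apply, LinearMap.comp_apply, LinearEquiv.coe_coe, comul_M, map_sum,
      LinearMap.rTensor_tmul, LinearMap.lTensor_tmul, TensorProduct.sum_tmul,
      TensorProduct.tmul_sum, TensorProduct.assoc_tmul]
    rw [Finset.sum_sigma', Finset.sum_sigma']
    refine Finset.sum_bij' (fun p _ => ⟨p.2, p.1 - p.2⟩) (fun p _ => ⟨p.1 + p.2, p.1⟩) ?_ ?_ ?_ ?_ ?_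
    · rintro ⟨i, j⟩ h
      simp only [Finset.mem_sigma, Finset.mem_range, List.length_take, List.length_drop] at h ⊢
      omega
    · rintro ⟨i, j⟩ h
      simp only [Finset.mem_sigma, Finset.mem_range, List.length_take, List.length_drop] at h ⊢
      omega
    · rintro ⟨i, j⟩ h
      simp only [Finset.mem_sigma, Finset.mem_range, List.length_take] at h
      simp only [Sigma.mk.injEq, heq_eq_eq, and_true]
      omega
    · rintro ⟨i, j⟩ h
      simp
    · rintro ⟨i, j⟩ h
      simp only [Finset.mem_sigma, Finset.mem_range, List.length_take] at h
      have h1 : min j i = j := by omega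
      have h2 : j + (i - j) = i := by omega
      simp only [List.take_take, List.drop_drop, List.drop_take, h1, h2]
  rTensor_counit_comp_comul := by
    refine (monomialBasis R).ext fun α => ?_
    simp only [monomialBasis_apply, LinearMap.comp_apply, comul_M, map_sum,
      LinearMap.rTensor_tmul, counit_M, TensorProduct.mk_apply]
    rw [Finset.sum_eq_single_of_mem 0 (by simp)]
    · simp
    · intro i hi h0
      rw [if_neg, TensorProduct.zero_tmul]
      intro h
      rw [List.take_eq_nil_iff] at h
      rcases h with h | h
      · exact h0 h
      · subst h
        simp at hi
        exact h0 hi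
  lTensor_counit_comp_comul := by
    refine (monomialBasis R).ext fun α => ?_
    simp only [monomialBasis_apply, LinearMap.comp_apply, comul_M, map_sum,
      LinearMap.lTensor_tmul, counit_M, LinearMap.flip_apply, TensorProduct.mk_apply]
    rw [Finset.sum_eq_single_of_mem α.length (by simp)]
    · simp
    · intro i hi h0
      rw [if_neg, TensorProduct.tmul_zero]
      intro h
      rw [List.drop_eq_nil_iff] at h
      simp at hi
      omega

variable (R) in
/-- The coefficient of `x ^ d` as a linear functional on quasisymmetric functions. -/
def coeffLin (d : ℕ →₀ ℕ) : QSym R →ₗ[R] R :=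
  (MvPowerSeries.coeff d).comp (qsymSubalgebra R).val.toLinearMap

theorem coeffLin_M (d : ℕ →₀ ℕ) (α : Comp) :
    coeffLin R d (M R α) = if shape d = α then 1 else 0 := rfl

theorem coeffLin_mul (d : ℕ →₀ ℕ) (F G : QSym R) :
    coeffLin R d (F * G) =
      ∑ p ∈ Finset.HasAntidiagonal.antidiagonal d, coeffLin R p.1 F * coeffLin R p.2 G :=
  MvPowerSeries.coeff_mul _ _ _

variable (R) in
/-- The functional reading off the coefficient of `x ^ a ⊗ x ^ b`. -/
def coeffTensor (a b : ℕ →₀ ℕ) : QSym R ⊗[R] QSym R →ₗ[R] R :=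
  LinearMap.mul' R R ∘ₗ TensorProduct.map (coeffLin R a) (coeffLin R b)

@[simp] theorem coeffTensor_tmul (a b : ℕ →₀ ℕ) (F G : QSym R) :
    coeffTensor R a b (F ⊗ₜ G) = coeffLin R a F * coeffLin R b G := rfl

theorem shape_add {a b : ℕ →₀ ℕ} (h : ∀ i ∈ a.support, ∀ j ∈ b.support, i < j) :
    shape (a + b) = shape a ++ shape b := by
  have hd : Disjoint a.support b.support := by
    rw [Finset.disjoint_left]
    intro i hi hi'
    exact lt_irrefl _ (h i hi i hi')
  have hs : (a + b).support.sort (· ≤ ·) = a.support.sort (· ≤ ·) ++ b.support.sort (· ≤ ·) := by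
    rw [Finsupp.support_add_eq hd]
    have e : a.support ∪ b.support =
        (a.support.sort (· ≤ ·) ++ b.support.sort (· ≤ ·)).toFinset := by
      ext i; simp
    rw [e, List.toFinset_sort]
    · rw [List.pairwise_append]
      refine ⟨Finset.pairwise_sort _ _, Finset.pairwise_sort _ _, fun i hi j hj => ?_⟩
      exact (h i (by simpa using hi) j (by simpa using hj)).le
    · rw [List.nodup_append]
      refine ⟨Finset.sort_nodup _ _, Finset.sort_nodup _ _, fun i hi j hj => ?_⟩
      exact (h i (by simpa using hi) j (by simpa using hj)).ne
  unfold shape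
  rw [hs, List.map_append]
  congr 1
  · refine List.map_congr_left fun i hi => ?_
    have hi' : i ∈ a.support := by simpa using hi
    have : b i = 0 := by
      by_contra hb
      exact lt_irrefl _ (h i hi' i (Finsupp.mem_support_iff.2 hb))
    simp [this]
  · refine List.map_congr_left fun i hi => ?_
    have hi' : i ∈ b.support := by simpa using hi
    have : a i = 0 := by
      by_contra hb
      exact lt_irrefl _ (h i (Finsupp.mem_support_iff.2 hb) i hi')
    simp [this]

theorem coeffTensor_comul {a b : ℕ →₀ ℕ} (h : ∀ i ∈ a.support, ∀ j ∈ b.support, i < j)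
    (F : QSym R) : coeffTensor R a b (comul F) = coeffLin R (a + b) F := by
  have : coeffTensor R a b ∘ₗ comul = coeffLin R (a + b) := by
    refine (monomialBasis R).ext fun α => ?_
    simp only [LinearMap.comp_apply, monomialBasis_apply, comul_M, map_sum, coeffTensor_tmul,
      coeffLin_M, shape_add h]
    by_cases hα : shape a ++ shape b = α
    · subst hα
      rw [if_pos rfl, Finset.sum_eq_single_of_mem (shape a).length (by simp)]
      · simp
      · intro i hi hne
        rw [if_neg, zero_mul]
        intro h1
        have := congrArg List.length h1
        simp at this hi
        omega
    · rw [if_neg hα]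
      refine Finset.sum_eq_zero fun i _ => ?_
      by_cases h1 : shape a = α.take i
      · by_cases h2 : shape b = α.drop i
        · exact absurd (by rw [h1, h2, List.take_append_drop]) hα
        · rw [if_neg h2, mul_zero]
      · rw [if_neg h1, zero_mul]
  exact LinearMap.congr_fun this F

theorem tensor_ext {X Y : QSym R ⊗[R] QSym R}
    (h : ∀ a b : ℕ →₀ ℕ, (∀ i ∈ a.support, ∀ j ∈ b.support, i < j) →
      coeffTensor R a b X = coeffTensor R a b Y) : X = Y := by
  refine ((monomialBasis R).tensorProduct (monomialBasis R)).ext_elem ?_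
  rintro ⟨β, γ⟩
  let f : ℕ ↪o ℕ := OrderEmbedding.ofStrictMono (fun n => β.length + n)
    (fun a b hab => by simpa using hab)
  have key : ∀ Z : QSym R ⊗[R] QSym R,
      ((monomialBasis R).tensorProduct (monomialBasis R)).repr Z (β, γ) =
      coeffTensor R (packed β) ((packed γ).embDomain f.toEmbedding) Z := by
    have : ((monomialBasis R).tensorProduct (monomialBasis R)).coord (β, γ) =
        coeffTensor R (packed β) ((packed γ).embDomain f.toEmbedding) := by
      refine ((monomialBasis R).tensorProduct (monomialBasis R)).ext ?_
      rintro ⟨β', γ'⟩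
      rw [Module.Basis.coord_apply, Module.Basis.repr_self, Module.Basis.tensorProduct_apply,
        monomialBasis_apply, monomialBasis_apply, coeffTensor_tmul, coeffLin_M, coeffLin_M,
        shape_embDomain, shape_packed, shape_packed, Finsupp.single_apply]
      by_cases h1 : β = β' <;> by_cases h2 : γ = γ' <;> simp [h1, h2, eq_comm]
    intro Z
    exact LinearMap.congr_fun this Z
  rw [key, key]
  refine h _ _ ?_
  intro i hi j hj
  rw [support_packed] at hi
  rw [Finsupp.support_embDomain, support_packed] at hj
  simp only [Finset.mem_range, Finset.mem_map] at hi hj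
  obtain ⟨k, -, rfl⟩ := hj
  have : f.toEmbedding k = β.length + k := rfl
  omega

theorem coeffTensor_mul (a b : ℕ →₀ ℕ) (X Y : QSym R ⊗[R] QSym R) :
    coeffTensor R a b (X * Y) =
      ∑ p ∈ Finset.HasAntidiagonal.antidiagonal a, ∑ q ∈ Finset.HasAntidiagonal.antidiagonal b,
        coeffTensor R p.1 q.1 X * coeffTensor R p.2 q.2 Y := by
  induction X using TensorProduct.induction_on with
  | zero => simp
  | add X X' hX hX' => simp only [add_mul, map_add, hX, hX', Finset.sum_add_distrib]
  | tmul F G =>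
    induction Y using TensorProduct.induction_on with
    | zero => simp
    | add Y Y' hY hY' => simp only [mul_add, map_add, hY, hY', Finset.sum_add_distrib]
    | tmul F' G' =>
      rw [Algebra.TensorProduct.tmul_mul_tmul, coeffTensor_tmul, coeffLin_mul, coeffLin_mul,
        Finset.sum_mul_sum]
      refine Finset.sum_congr rfl fun p _ => Finset.sum_congr rfl fun q _ => ?_
      simp only [coeffTensor_tmul]
      ring

theorem comul_mul_qsym (F G : QSym R) :
    comul (R := R) (F * G) = comul (R := R) F * comul (R := R) G := by
  refine tensor_ext fun a b h => ?_
  have hab : ∀ i, a i = 0 ∨ b i = 0 := by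
    intro i
    by_contra hc
    rw [not_or] at hc
    exact lt_irrefl _ (h i (Finsupp.mem_support_iff.2 hc.1) i (Finsupp.mem_support_iff.2 hc.2))
  rw [coeffTensor_comul h, coeffLin_mul, coeffTensor_mul, Finset.sum_sigma']
  symm
  refine Finset.sum_bij' (fun s _ => (s.1.1 + s.2.1, s.1.2 + s.2.2))
    (fun p _ => ⟨(p.1.filter (· ∈ a.support), p.2.filter (· ∈ a.support)),
      (p.1.filter (· ∉ a.support), p.2.filter (· ∉ a.support))⟩) ?_ ?_ ?_ ?_ ?_
  · rintro ⟨⟨a1, a2⟩, ⟨b1, b2⟩⟩ hs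
    simp only [Finset.mem_sigma, Finset.HasAntidiagonal.mem_antidiagonal] at hs ⊢
    rw [← hs.1, ← hs.2]
    abel
  · rintro ⟨p, q⟩ hp
    simp only [Finset.mem_sigma, Finset.HasAntidiagonal.mem_antidiagonal] at hp ⊢
    constructor
    · ext i
      have := DFunLike.congr_fun hp i
      have := hab i
      simp only [Finsupp.add_apply, Finsupp.filter_apply, Finsupp.mem_support_iff] at *
      split_ifs <;> omega
    · ext i
      have := DFunLike.congr_fun hp i
      have := hab i
      simp only [Finsupp.add_apply, Finsupp.filter_apply, Finsupp.mem_support_iff] at *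
      split_ifs <;> omega
  · rintro ⟨⟨a1, a2⟩, ⟨b1, b2⟩⟩ hs
    simp only [Finset.mem_sigma, Finset.HasAntidiagonal.mem_antidiagonal] at hs
    have h1 := fun i => DFunLike.congr_fun hs.1 i
    have h2 := fun i => DFunLike.congr_fun hs.2 i
    simp only [Finsupp.add_apply] at h1 h2
    simp only [Sigma.mk.injEq, Prod.mk.injEq, heq_eq_eq]
    refine ⟨⟨?_, ?_⟩, ?_, ?_⟩ <;>
    · ext i
      have := h1 i
      have := h2 i
      have := hab i
      simp only [Finsupp.add_apply, Finsupp.filter_apply, Finsupp.mem_support_iff]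
      split_ifs <;> omega
  · rintro ⟨p, q⟩ hp
    simp only [Finsupp.filter_add_filter_not]
  · rintro ⟨⟨a1, a2⟩, ⟨b1, b2⟩⟩ hs
    simp only [Finset.mem_sigma, Finset.HasAntidiagonal.mem_antidiagonal] at hs
    have h1 := fun i => DFunLike.congr_fun hs.1 i
    have h2 := fun i => DFunLike.congr_fun hs.2 i
    simp only [Finsupp.add_apply] at h1 h2
    rw [coeffTensor_comul, coeffTensor_comul]
    · intro i hi j hj
      dsimp only at hi hj
      have := h1 i
      have := h2 j
      refine h i ?_ j ?_ <;> rw [Finsupp.mem_support_iff] at * <;> omega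
    · intro i hi j hj
      dsimp only at hi hj
      have := h1 i
      have := h2 j
      refine h i ?_ j ?_ <;> rw [Finsupp.mem_support_iff] at * <;> omega

theorem shape_eq_nil {d : ℕ →₀ ℕ} : shape d = [] ↔ d = 0 := by
  rw [shape, List.map_eq_nil_iff, ← Finsupp.support_eq_empty, ← List.length_eq_zero_iff,
    Finset.length_sort, Finset.card_eq_zero]

variable (R) in
theorem M_nil : M R [] = 1 := by
  refine Subtype.ext (MvPowerSeries.ext fun d => ?_)
  have h : MvPowerSeries.coeff d (M R [] : MvPowerSeries ℕ R) = if shape d = [] then 1 else 0 :=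
    rfl
  rw [h]
  simp only [shape_eq_nil]
  rw [OneMemClass.coe_one, MvPowerSeries.coeff_one]

theorem counit_eq_coeffLin : counit (R := R) (A := QSym R) = coeffLin R 0 := by
  refine (monomialBasis R).ext fun α => ?_
  rw [monomialBasis_apply, counit_M, coeffLin_M, shape_eq_nil.2 rfl]
  simp only [eq_comm]

instance : Bialgebra R (QSym R) :=
  Bialgebra.mk' R (QSym R)
    (by rw [← M_nil, counit_M, if_pos rfl])
    (by intro F G; rw [counit_eq_coeffLin, coeffLin_mul]; simp)
    (by rw [← M_nil, comul_M]; simp [M_nil, Algebra.TensorProduct.one_def])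
    (by intro F G; exact comul_mul_qsym F G)

variable (R) in
/-- The left convolution inverse of the identity: `S(1) = 1` and
`S(M_α) = - ∑ S(M_β) M_γ`, the sum over all `α = β ⋅ γ` with `γ` nonempty. -/
def antipodeM : Comp → QSym R
  | [] => 1
  | a :: α => - ∑ i : Fin (a :: α).length,
      antipodeM ((a :: α).take i) * M R ((a :: α).drop i)
termination_by α => α.length
decreasing_by simp only [List.length_take]; omega

variable (R) in
/-- The right convolution inverse of the identity. -/
def antipodeM' : Comp → QSym R
  | [] => 1
  | a :: α => - ∑ i : Fin (a :: α).length,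
      M R ((a :: α).take (i + 1)) * antipodeM' ((a :: α).drop (i + 1))
termination_by α => α.length
decreasing_by simp only [List.length_drop, List.length_cons]; omega

variable (R) in
/-- The antipode as a linear map. -/
def antipodeLin : QSym R →ₗ[R] QSym R := (monomialBasis R).constr R (antipodeM R)

variable (R) in
/-- The right convolution inverse of the identity as a linear map. -/
def antipodeLin' : QSym R →ₗ[R] QSym R := (monomialBasis R).constr R (antipodeM' R)

theorem antipodeLin_M (α : Comp) : antipodeLin R (M R α) = antipodeM R α := by
  rw [← monomialBasis_apply]
  exact Module.Basis.constr_basis _ _ _ _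

theorem antipodeLin'_M (α : Comp) : antipodeLin' R (M R α) = antipodeM' R α := by
  rw [← monomialBasis_apply]
  exact Module.Basis.constr_basis _ _ _ _

theorem mul_antipode_left :
    LinearMap.mul' R (QSym R) ∘ₗ (antipodeLin R).rTensor (QSym R) ∘ₗ comul =
      Algebra.linearMap R (QSym R) ∘ₗ counit := by
  refine (monomialBasis R).ext fun α => ?_
  simp only [LinearMap.comp_apply, monomialBasis_apply, comul_M, map_sum, LinearMap.rTensor_tmul,
    LinearMap.mul'_apply, antipodeLin_M, counit_M, Algebra.linearMap_apply]
  cases α with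
  | nil => simp [antipodeM, M_nil]
  | cons a α =>
    rw [Finset.sum_range_succ, Finset.sum_range, List.take_length, List.drop_length, M_nil,
      mul_one, antipodeM, add_neg_cancel]
    simp

theorem mul_antipode_right' :
    LinearMap.mul' R (QSym R) ∘ₗ (antipodeLin' R).lTensor (QSym R) ∘ₗ comul =
      Algebra.linearMap R (QSym R) ∘ₗ counit := by
  refine (monomialBasis R).ext fun α => ?_
  simp only [LinearMap.comp_apply, monomialBasis_apply, comul_M, map_sum, LinearMap.lTensor_tmul,
    LinearMap.mul'_apply, antipodeLin'_M, counit_M, Algebra.linearMap_apply]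
  cases α with
  | nil => simp [antipodeM', M_nil]
  | cons a α =>
    rw [Finset.sum_range_succ', Finset.sum_range, List.take_zero, List.drop_zero, M_nil,
      one_mul, antipodeM', add_neg_cancel]
    simp

theorem antipodeLin_eq : antipodeLin R = antipodeLin' R := by
  have h1 : WithConv.toConv (antipodeLin R) * WithConv.toConv LinearMap.id = 1 := by
    refine WithConv.ofConv_injective ?_
    exact mul_antipode_left
  have h2 : WithConv.toConv LinearMap.id * WithConv.toConv (antipodeLin' R) = 1 := by
    refine WithConv.ofConv_injective ?_
    exact mul_antipode_right'
  exact WithConv.toConv_injective (left_inv_eq_right_inv h1 h2)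

instance : HopfAlgebra R (QSym R) where
  antipode := antipodeLin R
  mul_antipode_rTensor_comul := mul_antipode_left
  mul_antipode_lTensor_comul := by rw [antipodeLin_eq]; exact mul_antipode_right'

variable (R) in
/-- The homogeneous component of degree `n`, spanned by the `M_α` with `α ∈ Comp(n)`. -/
def homogeneous (n : ℕ) : Submodule R (QSym R) :=
  Submodule.span R (M R '' {α | size α = n})

/-- A linear operator on `QSym R` is an endomorphism of the graded Hopf algebra `QSym R` if it is
a morphism of algebras and of coalgebras (a bialgebra morphism between Hopf algebras commutes
with the antipodes) and preserves degrees. -/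
def IsGradedHopfEnd (Φ : QSym R →ₗ[R] QSym R) : Prop :=
  (∃ Ψ : QSym R →ₐc[R] QSym R, ∀ F, Ψ F = Φ F) ∧
    ∀ n, ∀ F ∈ homogeneous R n, Φ F ∈ homogeneous R n

end

/-! ### The matrices `A_n` -/

/-- `p` is a Lyndon expansion of `M_β`: a polynomial with rational coefficients in variables
`u_α`, one for every Lyndon composition `α`, which becomes `M_β` when each `u_α` is replaced
by `M_α`. -/
def IsLyndonExpansion (β : Comp) (p : MvPolynomial Lyndon ℚ) : Prop :=
  MvPolynomial.aeval (fun α : Lyndon => M ℚ α.1) p = M ℚ β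

/-- The Lyndon expansion of `M_β`, that is, the polynomial `A_n(β, n)` for `β ∈ Comp(n)`. -/
def lyndonExpansion (β : Comp) : MvPolynomial Lyndon ℚ :=
  Classical.epsilon (IsLyndonExpansion β)

open Classical in
/-- The matrix entry `A_n(β, α)` for `α, β ∈ Comp(n)`: it is
`A_{a₁}(β₁, a₁) ⋯ A_{aₖ}(βₖ, aₖ)` if `α = (a₁, …, aₖ) ≤ β` and `β = β₁ ⋯ βₖ` with `aᵢ = |βᵢ|`,
and `0` if `α ≰ β`. -/
def entry (β α : Comp) : MvPolynomial Lyndon ℚ :=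
  if h : Refines β α then (h.choose.map lyndonExpansion).prod else 0

theorem entry_of_cuts {L : List Comp} {β α : Comp} (h : Cuts L β α) :
    entry β α = (L.map lyndonExpansion).prod := by
  have h' : Refines β α := ⟨L, h⟩
  rw [entry, dif_pos h', h'.choose_spec.unique h]

end QuasiSym

end

/-!
Two facts carry the proof.

**Freeness.** The monomial functions `M_α`, `α` Lyndon, are free polynomial generators of
quasisymmetric functions over a field of characteristic `0` (`aeval_lyndon_bijective`). By the
Chen–Fox–Lyndon theorem, every composition is the concatenation of a unique nonincreasing sequence
of Lyndon words, so that monomials in the variables `u_α` correspond to compositions. If `β` has the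
factorization `w₁ ≥ ⋯ ≥ wₖ`, then `M_β` is the leading term of `M_{w₁} ⋯ M_{wₖ}`
(`IsFactorization.hasLeadingTerm`) for the order by length, then lexicographic: the terms of
maximal length of a product are the shuffles, and the largest shuffle is the concatenation of all
Lyndon factors in nonincreasing order (`Shuffle.le_sortedFlatten`). Hence the products form a
triangular system with respect to the monomial basis. Consequently a character
`χ : QSym K →ₐ[K] K` is the same as an assignment of values to the `u_α`, and `χ (M_β)` is the value
of the Lyndon expansion of `M_β`.

**Universality.** Graded Hopf endomorphisms correspond to characters. With `χ_c` the component of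
degree `c` of `χ`, the operator `ofCharacter χ` has `(χ_{a₁} ⊗ ⋯ ⊗ χ_{aₖ}) ∘ Δ^{(k)}` as its
coordinate at `α = (a₁, …, aₖ)`; on `M_β` this is the matrix entry `A_n(β, α)`. These functionals
are products in the convolution algebra, which gives compatibility with the coproduct. For the
canonical character `ζ` (evaluation at `x₀ = 1` and `xᵢ = 0` for `i > 0`) they are the coordinates
in the monomial basis, and the operators `strip χ c = (χ_c ⊗ id) ∘ Δ` satisfy
`strip ζ c ∘ ofCharacter χ = ofCharacter χ ∘ strip χ c`; as they also satisfy a Leibniz rule,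
multiplicativity follows by induction on the parts of `α`. The same intertwining relation shows
that an endomorphism `Ψ` is `ofCharacter (ζ ∘ Ψ)`.
-/

noncomputable section

namespace QuasiSym

/-! ### Lexicographic order and Lyndon words -/

section Words

variable {A : Type*} [LinearOrder A]

theorem append_le_append_left (l : List A) {m n : List A} (h : m ≤ n) : l ++ m ≤ l ++ n := by
  rcases h.lt_or_eq with h | rfl
  · exact (List.append_left_lt h).le
  · exact le_rfl

theorem le_append_right (l m : List A) : l ≤ l ++ m := by
  simpa using append_le_append_left l (not_lt.1 (List.not_lt_nil m))

/-- If `u < v`, either `u` is a prefix of `v` or the first difference decides, and then appending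
words does not matter. -/
theorem prefix_or_append_lt_append {u v : List A} (h : u < v) :
    u <+: v ∨ ∀ x y, u ++ x < v ++ y := by
  induction u generalizing v with
  | nil => exact Or.inl (List.nil_prefix)
  | cons a u ih =>
    cases v with
    | nil => exact absurd h (List.not_lt_nil _)
    | cons b v =>
      rcases List.cons_lt_cons_iff.1 h with h | ⟨rfl, h2⟩
      · exact Or.inr fun x y => List.cons_lt_cons_iff.2 (Or.inl h)
      · rcases ih h2 with h' | h'
        · exact Or.inl ((List.prefix_cons_inj a).2 h')
        · exact Or.inr fun x y => List.cons_lt_cons_iff.2 (Or.inr ⟨rfl, h' x y⟩)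

theorem append_lt_append_of_length_le {u v : List A} (h : u < v) (hl : v.length ≤ u.length)
    (x y : List A) : u ++ x < v ++ y := by
  rcases prefix_or_append_lt_append h with h' | h'
  · exact absurd (h'.eq_of_length_le hl) h.ne
  · exact h' x y

theorem lt_of_append_lt_append {l m n : List A} (h : l ++ m < l ++ n) : m < n := by
  by_contra hc
  exact absurd h (not_lt.2 (append_le_append_left l (not_lt.1 hc)))

/-- A Lyndon word, characterized by its suffixes: a nonempty word that is smaller than each of
its proper nonempty suffixes. -/
def LyndonWord (w : List A) : Prop :=
  w ≠ [] ∧ ∀ u v, u ≠ [] → v ≠ [] → w = u ++ v → w < v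

theorem lyndonWord_singleton (a : A) : LyndonWord [a] := by
  refine ⟨by simp, fun u v hu hv h => ?_⟩
  have := congrArg List.length h
  have := List.length_pos_iff.2 hu
  have := List.length_pos_iff.2 hv
  simp at *
  omega

theorem LyndonWord.append_lt_right {u v : List A} (hu : u ≠ []) (hv : LyndonWord v) (h : u < v) :
    u ++ v < v := by
  rcases prefix_or_append_lt_append h with ⟨t, rfl⟩ | h'
  · refine List.append_left_lt (hv.2 u t hu ?_ rfl)
    rintro rfl
    simp at h
  · simpa using h' v []

theorem LyndonWord.append {u v : List A} (hu : LyndonWord u) (hv : LyndonWord v) (h : u < v) :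
    LyndonWord (u ++ v) := by
  have huv := hv.append_lt_right hu.1 h
  refine ⟨by simp [hu.1], fun x y hx hy he => ?_⟩
  rcases List.append_eq_append_iff.1 he with ⟨t, rfl, rfl⟩ | ⟨t, rfl, rfl⟩
  · rcases eq_or_ne t [] with rfl | ht
    · simpa using huv
    · exact huv.trans (hv.2 t y ht hy rfl)
  · rcases eq_or_ne t [] with rfl | ht
    · simpa using huv
    · exact append_lt_append_of_length_le (hu.2 x t hx ht rfl) (by simp) _ _

theorem LyndonWord.append_le_append_swap {u v : List A} (hu : LyndonWord u) (hv : LyndonWord v)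
    (h : u ≤ v) : u ++ v ≤ v ++ u := by
  rcases h.lt_or_eq with h | rfl
  · exact ((hu.append hv h).2 u v hu.1 hv.1 rfl).le.trans (le_append_right v u)
  · exact le_rfl

/-- A word that is smaller than its nontrivial rotations is smaller than its proper suffixes. -/
theorem lyndonWord_of_isLyndon {w : Comp} (h : IsLyndon w) : LyndonWord w := by
  refine ⟨h.1, ?_⟩
  rintro u v hu hv rfl
  have rot : ∀ x y : Comp, u ++ v = x ++ y → x ≠ [] → y ≠ [] → u ++ v < y ++ x := by
    intro x y he hx hy
    have := h.2 x.length (List.length_pos_iff.2 hx)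
      (by rw [he, List.length_append]; have := List.length_pos_iff.2 hy; omega)
    rwa [he, List.rotate_append_length_eq, ← he] at this
  have h1 := rot u v rfl hu hv
  by_contra hc
  have hlt : v < u ++ v := by
    refine lt_of_le_of_ne (not_lt.1 hc) fun he => hu ?_
    simpa using congrArg List.length he
  rcases prefix_or_append_lt_append hlt with ⟨t, ht⟩ | h'
  · -- if `v` were a border, `u ++ v = v ++ t`, rotating by `v` would contradict rotating by `u`
    have hlen : t.length = u.length := by
      have := congrArg List.length ht
      simp at this
      omega
    have h2 : t < u := by rw [← ht] at h1; exact lt_of_append_lt_append h1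
    have h3 := rot v t ht.symm hv (by rintro rfl; exact hu (List.length_eq_zero_iff.1 hlen.symm))
    exact lt_asymm h3 (append_lt_append_of_length_le h2 hlen.ge _ _)
  · exact lt_asymm h1 (by simpa using h' u [])

theorem isLyndon_of_lyndonWord {w : Comp} (h : LyndonWord w) : IsLyndon w := by
  refine ⟨h.1, fun i hi hl => ?_⟩
  rw [List.rotate_eq_drop_append_take hl.le]
  refine (h.2 (w.take i) (w.drop i) ?_ ?_ (List.take_append_drop i w).symm).trans_le
    (le_append_right _ _)
  · rw [Ne, List.take_eq_nil_iff]; rintro (h0 | h0)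
    · omega
    · exact h.1 h0
  · rw [Ne, List.drop_eq_nil_iff]; omega

theorem isLyndon_iff {w : Comp} : IsLyndon w ↔ LyndonWord w :=
  ⟨lyndonWord_of_isLyndon, isLyndon_of_lyndonWord⟩

/-! ### The Chen–Fox–Lyndon factorization -/

/-- A nonincreasing sequence of Lyndon words. -/
def IsFactorization (l : List (List A)) : Prop :=
  l.Pairwise (· ≥ ·) ∧ ∀ w ∈ l, LyndonWord w

/-- Put the word `x` in front of a nonincreasing sequence of words, amalgamating it with the
first words of the sequence as long as they are larger. -/
def absorb (x : List A) : List (List A) → List (List A)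
  | [] => [x]
  | l :: ls => if x < l then absorb (x ++ l) ls else x :: l :: ls

/-- The nonincreasing factorization of a word into Lyndon words. -/
def factorization : List A → List (List A)
  | [] => []
  | a :: u => absorb [a] (factorization u)

theorem flatten_absorb (x : List A) (ls : List (List A)) :
    (absorb x ls).flatten = x ++ ls.flatten := by
  induction ls generalizing x with
  | nil => simp [absorb]
  | cons l ls ih =>
    rw [absorb]
    split_ifs
    · simp [ih]
    · simp

theorem IsFactorization.absorb {x : List A} (hx : LyndonWord x) {ls : List (List A)}
    (h : IsFactorization ls) : IsFactorization (absorb x ls) := by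
  induction ls generalizing x with
  | nil => simpa [QuasiSym.absorb, IsFactorization] using hx
  | cons l ls ih =>
    rw [QuasiSym.absorb]
    have hp := List.pairwise_cons.1 h.1
    split_ifs with hlt
    · exact ih (hx.append (h.2 l (by simp)) hlt) ⟨hp.2, fun w hw => h.2 w (by simp [hw])⟩
    · refine ⟨List.pairwise_cons.2 ⟨fun w hw => ?_, h.1⟩, fun w hw => ?_⟩
      · rcases List.mem_cons.1 hw with rfl | hw
        · exact not_lt.1 hlt
        · exact (hp.1 w hw).trans (not_lt.1 hlt)
      · rcases List.mem_cons.1 hw with rfl | hw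
        · exact hx
        · exact h.2 w hw

theorem isFactorization_factorization (u : List A) : IsFactorization (factorization u) := by
  induction u with
  | nil => simp [factorization, IsFactorization]
  | cons a u ih => exact ih.absorb (lyndonWord_singleton a)

theorem flatten_factorization (u : List A) : (factorization u).flatten = u := by
  induction u with
  | nil => rfl
  | cons a u ih => simp [factorization, flatten_absorb, ih]

/-- A nonempty prefix of a concatenation of words that are at most `w` ends inside one of these
words, so it has a nonempty suffix that is at most `w`. -/
theorem exists_suffix_le_of_prefix_flatten {w : List A} {ls : List (List A)} {y : List A}
    (hw : ∀ l ∈ ls, l ≤ w) (hy : y ≠ []) (h : y <+: ls.flatten) :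
    ∃ x p, y = x ++ p ∧ p ≠ [] ∧ p ≤ w := by
  induction ls generalizing y with
  | nil => simp at h; exact absurd h hy
  | cons l ls ih =>
    have hlw := hw l (by simp)
    obtain ⟨z, hz⟩ := h
    rw [List.flatten_cons] at hz
    rcases List.append_eq_append_iff.1 hz with ⟨t, rfl, -⟩ | ⟨t, rfl, ht⟩
    · exact ⟨[], y, rfl, hy, (le_append_right y t).trans hlw⟩
    · rcases eq_or_ne t [] with rfl | h0
      · exact ⟨[], l, by simp, by simpa using hy, hlw⟩
      · obtain ⟨x, p, rfl, hp, hpw⟩ := ih (fun l hl => hw l (by simp [hl])) h0 ⟨z, ht.symm⟩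
        exact ⟨l ++ x, p, by simp, hp, hpw⟩

/-- Uniqueness of the Chen–Fox–Lyndon factorization. If the first factors `w` and `v` had
different lengths, say `v = w ++ y` with `y ≠ []`, then `y` would have a nonempty suffix that is a
prefix of some later factor, hence at most `w < v`, although `v` is smaller than its suffixes. -/
theorem IsFactorization.eq_of_flatten_eq {l m : List (List A)} (hl : IsFactorization l)
    (hm : IsFactorization m) (h : l.flatten = m.flatten) : l = m := by
  have key : ∀ (w v m : List A) (l : List (List A)), IsFactorization (w :: l) → LyndonWord v →
      w ++ l.flatten = v ++ m → v.length ≤ w.length := by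
    intro w v m l hl hv he
    by_contra hc
    rcases List.append_eq_append_iff.1 he with ⟨y, rfl, hy⟩ | ⟨y, rfl, -⟩
    · have hy0 : y ≠ [] := by rintro rfl; simp at hc
      obtain ⟨x, p, rfl, hp, hpw⟩ := exists_suffix_le_of_prefix_flatten
        (List.pairwise_cons.1 hl.1).1 hy0 ⟨m, hy.symm⟩
      exact absurd (hv.2 (w ++ x) p (by simp [(hl.2 w (by simp)).1]) hp (by simp))
        (not_lt.2 (hpw.trans (le_append_right _ _)))
    · simp at hc
  induction l generalizing m with
  | nil =>
    cases m with
    | nil => rfl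
    | cons v m => simp [(hm.2 v (by simp)).1] at h
  | cons w l ih =>
    cases m with
    | nil => simp [(hl.2 w (by simp)).1] at h
    | cons v m =>
      rw [List.flatten_cons, List.flatten_cons] at h
      obtain ⟨rfl, h'⟩ := List.append_inj h (le_antisymm
        (key v w _ m hm (hl.2 w (by simp)) h.symm) (key w v _ l hl (hm.2 v (by simp)) h))
      rw [ih ⟨(List.pairwise_cons.1 hl.1).2, fun w hw => hl.2 w (by simp [hw])⟩
        ⟨(List.pairwise_cons.1 hm.1).2, fun w hw => hm.2 w (by simp [hw])⟩ h']

/-- The concatenation of a list of words, taken in nonincreasing order. -/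
def sortedFlatten (l : List (List A)) : List A := (l.insertionSort (· ≥ ·)).flatten

theorem sortedFlatten_perm {l m : List (List A)} (h : l.Perm m) :
    sortedFlatten l = sortedFlatten m := by
  unfold sortedFlatten
  congr 1
  refine List.Perm.eq_of_pairwise (le := (· ≥ ·)) (fun a b _ _ h1 h2 => le_antisymm h2 h1)
    (List.pairwise_insertionSort _ _) (List.pairwise_insertionSort _ _) ?_
  exact (List.perm_insertionSort _ _).trans (h.trans (List.perm_insertionSort _ _).symm)

theorem sortedFlatten_eq_flatten {l : List (List A)} (h : l.Pairwise (· ≥ ·)) :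
    sortedFlatten l = l.flatten := by
  rw [sortedFlatten, h.insertionSort_eq]

theorem sortedFlatten_cons_of_forall_le {x : List A} {l : List (List A)} (h : ∀ w ∈ l, w ≤ x) :
    sortedFlatten (x :: l) = x ++ sortedFlatten l := by
  rw [sortedFlatten, List.insertionSort_cons_of_forall_rel _ h, List.flatten_cons, sortedFlatten]

/-- Inserting a Lyndon word at its place gives a word at least as large as putting it in front,
because `x ++ y ≤ y ++ x` for Lyndon words `x < y`. -/
theorem append_sortedFlatten_le {x : List A} {l : List (List A)} (hx : LyndonWord x)
    (hl : ∀ w ∈ l, LyndonWord w) : x ++ sortedFlatten l ≤ sortedFlatten (x :: l) := by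
  have key : ∀ s : List (List A), (∀ w ∈ s, LyndonWord w) →
      x ++ s.flatten ≤ (s.orderedInsert (· ≥ ·) x).flatten := by
    intro s hs
    induction s with
    | nil => simp
    | cons y s ih =>
      rw [List.orderedInsert_cons]
      split_ifs with h
      · simp
      · have h1 := hx.append_le_append_swap (hs y (by simp)) (not_le.1 h).le
        rw [List.flatten_cons, List.flatten_cons]
        calc x ++ (y ++ s.flatten) = (x ++ y) ++ s.flatten := by simp
          _ ≤ (y ++ x) ++ s.flatten := by
            rcases h1.lt_or_eq with h1 | h1
            · exact (append_lt_append_of_length_le h1 (by simp [add_comm]) _ _).le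
            · rw [h1]
          _ = y ++ (x ++ s.flatten) := by simp
          _ ≤ _ := append_le_append_left _ (ih fun w hw => hs w (by simp [hw]))
  exact key _ fun w hw => hl w ((List.mem_insertionSort _).1 hw)

/-- Letting `x` absorb words of `ls` does not decrease the nonincreasing concatenation: a word
`m` of `ms` that exceeds the next word to be absorbed also exceeds `x` and can be moved to the
front. -/
theorem append_sortedFlatten_le_absorb {x : List A} {ls ms : List (List A)} (hx : LyndonWord x)
    (hl : IsFactorization ls) (hm : IsFactorization ms) :
    x ++ sortedFlatten (ls ++ ms) ≤ sortedFlatten (absorb x ls ++ ms) := by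
  induction ls generalizing x ms with
  | nil => exact append_sortedFlatten_le hx hm.2
  | cons l ls ihl =>
    have hl' := List.pairwise_cons.1 hl.1
    have hls : IsFactorization ls := ⟨hl'.2, fun w hw => hl.2 w (by simp [hw])⟩
    have hlL := hl.2 l (by simp)
    by_cases hxl : x < l
    · induction ms with
      | nil =>
        rw [absorb, if_pos hxl, List.append_nil, sortedFlatten_cons_of_forall_le hl'.1,
          ← List.append_assoc]
        simpa using ihl (hx.append hlL hxl) hls hm
      | cons m ms ihm =>
        have hm' := List.pairwise_cons.1 hm.1
        have hms : IsFactorization ms := ⟨hm'.2, fun w hw => hm.2 w (by simp [hw])⟩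
        have hmL := hm.2 m (by simp)
        rcases le_or_gt m l with hml | hml
        · -- `l` is the largest of all words, and `x` absorbs it
          rw [absorb, if_pos hxl, List.cons_append, sortedFlatten_cons_of_forall_le,
            ← List.append_assoc]
          · exact ihl (hx.append hlL hxl) hls hm
          · intro w hw
            rcases List.mem_append.1 hw with hw | hw
            · exact hl'.1 w hw
            · rcases List.mem_cons.1 hw with rfl | hw
              · exact hml
              · exact (hm'.1 w hw).trans hml
        · -- `m` is the largest of all words and `x < l < m`, so `m` can be moved in front of `x`
          rw [sortedFlatten_perm (List.perm_middle (l₁ := l :: ls)),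
            sortedFlatten_cons_of_forall_le, sortedFlatten_perm List.perm_middle]
          · have hxm := hx.append_le_append_swap hmL (hxl.trans hml).le
            calc x ++ (m ++ sortedFlatten (l :: ls ++ ms))
                = (x ++ m) ++ sortedFlatten (l :: ls ++ ms) := by simp
              _ ≤ (m ++ x) ++ sortedFlatten (l :: ls ++ ms) := by
                rcases hxm.lt_or_eq with h1 | h1
                · exact (append_lt_append_of_length_le h1 (by simp [add_comm]) _ _).le
                · rw [h1]
              _ = m ++ (x ++ sortedFlatten (l :: ls ++ ms)) := by simp
              _ ≤ m ++ sortedFlatten (absorb x (l :: ls) ++ ms) :=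
                append_le_append_left _ (ihm hms)
              _ ≤ _ := append_sortedFlatten_le hmL fun w hw => by
                rcases List.mem_append.1 hw with hw | hw
                · exact (hl.absorb hx).2 w hw
                · exact hms.2 w hw
          · intro w hw
            rcases List.mem_append.1 hw with hw | hw
            · rcases List.mem_cons.1 hw with rfl | hw
              · exact hml.le
              · exact (hl'.1 w hw).trans hml.le
            · exact hm'.1 w hw
    · rw [absorb, if_neg hxl]
      exact append_sortedFlatten_le hx fun w hw => by
        rcases List.mem_append.1 hw with hw | hw
        · exact hl.2 w hw
        · exact hm.2 w hw

/-! ### The largest shuffle -/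

/-- `Shuffle u v t`: the word `t` is a shuffle of the words `u` and `v`. -/
inductive Shuffle : List A → List A → List A → Prop
  | nil : Shuffle [] [] []
  | left (a : A) {u v t : List A} : Shuffle u v t → Shuffle (a :: u) v (a :: t)
  | right (a : A) {u v t : List A} : Shuffle u v t → Shuffle u (a :: v) (a :: t)

/-- Every shuffle of `u` and `v` is at most the nonincreasing concatenation of all Lyndon factors
of `u` and `v`. -/
theorem Shuffle.le_sortedFlatten {u v t : List A} (h : Shuffle u v t) :
    t ≤ sortedFlatten (factorization u ++ factorization v) := by
  induction h with
  | nil => exact not_lt.1 (List.not_lt_nil _)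
  | @left a u v t _ ih =>
    exact (List.cons_le_cons a ih).trans (append_sortedFlatten_le_absorb (lyndonWord_singleton a)
      (isFactorization_factorization u) (isFactorization_factorization v))
  | @right a u v t _ ih =>
    rw [sortedFlatten_perm List.perm_append_comm] at ih ⊢
    exact (List.cons_le_cons a ih).trans (append_sortedFlatten_le_absorb (lyndonWord_singleton a)
      (isFactorization_factorization v) (isFactorization_factorization u))

/-- Replacing `v` by a word `v'` of the same length, at the same positions of the shuffle, is
monotone. -/
theorem Shuffle.exists_shuffle_le {u v v' t : List A} (h : Shuffle u v t)
    (hl : v.length = v'.length) :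
    ∃ t', Shuffle u v' t' ∧ t.length = t'.length ∧ (v ≤ v' → t ≤ t') := by
  induction h generalizing v' with
  | nil =>
    obtain rfl := List.length_eq_zero_iff.1 hl.symm
    exact ⟨[], .nil, rfl, fun _ => le_rfl⟩
  | left a _ ih =>
    obtain ⟨t', h1, h2, h3⟩ := ih hl
    exact ⟨a :: t', .left a h1, by simp [h2], fun hv => List.cons_le_cons a (h3 hv)⟩
  | @right a u v t ht ih =>
    cases v' with
    | nil => simp at hl
    | cons b v' =>
      obtain ⟨t', h1, h2, h3⟩ := ih (v' := v') (by simpa using hl)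
      refine ⟨b :: t', .right b h1, by simp [h2], fun hv => ?_⟩
      rcases hv.lt_or_eq with hv | hv
      · rcases List.cons_lt_cons_iff.1 hv with hab | ⟨rfl, hv'⟩
        · exact (List.cons_lt_cons_iff.2 (Or.inl hab)).le
        · exact List.cons_le_cons a (h3 hv'.le)
      · obtain ⟨rfl, rfl⟩ := List.cons.inj hv
        exact List.cons_le_cons a (h3 le_rfl)

end Words

/-! ### Coordinates in the monomial basis -/

section Coordinates

variable {R : Type*} [CommRing R]

theorem coeffLin_eq_of_shape (F : QSym R) {d e : ℕ →₀ ℕ} (h : shape d = shape e) :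
    coeffLin R d F = coeffLin R e F :=
  coeff_eq_of_shape F h

theorem coeffLin_packed_shape (F : QSym R) (d : ℕ →₀ ℕ) :
    coeffLin R (packed (shape d)) F = coeffLin R d F :=
  coeffLin_eq_of_shape F (shape_packed _)

theorem monomialBasis_repr (F : QSym R) (α : Comp) :
    (monomialBasis R).repr F α = coeffLin R (packed α) F := by
  have : (monomialBasis R).coord α = coeffLin R (packed α) := by
    refine (monomialBasis R).ext fun β => ?_
    rw [Module.Basis.coord_apply, Module.Basis.repr_self, monomialBasis_apply, coeffLin_M,
      shape_packed, Finsupp.single_apply]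
    simp only [eq_comm]
  exact LinearMap.congr_fun this F

theorem ext_coeffLin_packed {F G : QSym R}
    (h : ∀ α, coeffLin R (packed α) F = coeffLin R (packed α) G) : F = G :=
  (monomialBasis R).ext_elem fun α => by rw [monomialBasis_repr, monomialBasis_repr, h]

theorem mem_homogeneous {n : ℕ} {F : QSym R} :
    F ∈ homogeneous R n ↔ ∀ α, coeffLin R (packed α) F ≠ 0 → size α = n := by
  have h : homogeneous R n = Submodule.span R (monomialBasis R '' {α | size α = n}) := by
    rw [homogeneous]
    simp
  rw [h, Module.Basis.mem_span_image]
  simp only [Set.subset_def, Finset.mem_coe, Finsupp.mem_support_iff, monomialBasis_repr,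
    Set.mem_ofPred_eq]

theorem M_mem_homogeneous (α : Comp) : M R α ∈ homogeneous R (size α) :=
  Submodule.subset_span ⟨α, rfl, rfl⟩

theorem mul_mem_homogeneous {m n : ℕ} {F G : QSym R} (hF : F ∈ homogeneous R m)
    (hG : G ∈ homogeneous R n) : F * G ∈ homogeneous R (m + n) := by
  rw [mem_homogeneous] at *
  intro α h
  rw [coeffLin_mul] at h
  obtain ⟨⟨a, b⟩, hp, hne⟩ := Finset.exists_ne_zero_of_sum_ne_zero h
  rw [Finset.HasAntidiagonal.mem_antidiagonal] at hp
  have ha := hF (shape a) (by rw [coeffLin_packed_shape]; exact left_ne_zero_of_mul hne)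
  have hb := hG (shape b) (by rw [coeffLin_packed_shape]; exact right_ne_zero_of_mul hne)
  rw [← shape_packed α, size_shape, ← hp, map_add, ← size_shape, ← size_shape, ha, hb]

theorem length_shape (d : ℕ →₀ ℕ) : (shape d).length = d.support.card := by
  simp [shape]

theorem length_shape_add_le (a b : ℕ →₀ ℕ) :
    (shape (a + b)).length ≤ (shape a).length + (shape b).length := by
  rw [length_shape, length_shape, length_shape]
  exact (Finset.card_le_card Finsupp.support_add).trans (Finset.card_union_le _ _)

theorem disjoint_support_of_length_shape_add {a b : ℕ →₀ ℕ}
    (h : (shape a).length + (shape b).length ≤ (shape (a + b)).length) :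
    Disjoint a.support b.support := by
  rw [length_shape, length_shape, length_shape] at h
  rw [Finset.disjoint_iff_inter_eq_empty, ← Finset.card_eq_zero]
  have h1 := Finset.card_union_add_card_inter a.support b.support
  have h2 := Finset.card_le_card (Finsupp.support_add (g₁ := a) (g₂ := b))
  omega

theorem shuffle_filter {A B : Type*} [LinearOrder A] (s : List B) (p : B → Prop)
    [DecidablePred p] {f g k : B → A} (hf : ∀ i ∈ s, p i → f i = k i)
    (hg : ∀ i ∈ s, ¬ p i → g i = k i) :
    Shuffle ((s.filter p).map f) ((s.filter (¬ p ·)).map g) (s.map k) := by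
  induction s with
  | nil => exact .nil
  | cons i s ih =>
    have ih' := ih (fun i hi => hf i (by simp [hi])) (fun i hi => hg i (by simp [hi]))
    by_cases h : p i
    · simpa [h, hf i (by simp) h] using ih'.left (k i)
    · simpa [h, hg i (by simp) h] using ih'.right (k i)

theorem shuffle_shape {a b : ℕ →₀ ℕ} (h : Disjoint a.support b.support) :
    Shuffle (shape a) (shape b) (shape (a + b)) := by
  have hsort : ∀ (s : Finset ℕ) (p : ℕ → Prop) [DecidablePred p],
      (s.sort (· ≤ ·)).filter p = (s.filter p).sort (· ≤ ·) := by
    intro s p _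
    refine (List.Perm.eq_of_pairwise (le := (· ≤ ·)) (fun a b _ _ h1 h2 => le_antisymm h1 h2)
      ((Finset.pairwise_sort s _).filter _) (Finset.pairwise_sort _ _) ?_)
    rw [List.perm_ext_iff_of_nodup ((Finset.sort_nodup _ _).filter _) (Finset.sort_nodup _ _)]
    simp
  have hs := Finsupp.support_add_eq h
  have ha : (a + b).support.filter (· ∈ a.support) = a.support := by
    rw [hs]; ext i; simp only [Finset.mem_filter, Finset.mem_union]; tauto
  have hb : (a + b).support.filter (¬ · ∈ a.support) = b.support := by
    rw [hs]; ext i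
    have : i ∈ a.support → i ∉ b.support := fun hi => Finset.disjoint_left.1 h hi
    simp only [Finset.mem_filter, Finset.mem_union]; tauto
  have key := shuffle_filter ((a + b).support.sort (· ≤ ·)) (· ∈ a.support)
    (f := fun i => (a i).toPNat') (g := fun i => (b i).toPNat')
    (k := fun i => ((a + b) i).toPNat') ?_ ?_
  · rw [hsort, hsort, ha, hb] at key
    exact key
  · intro i _ hi
    have := Finset.disjoint_left.1 h hi
    simp [Finsupp.notMem_support_iff.1 this]
  · intro i _ hi
    simp [Finsupp.notMem_support_iff.1 hi]

/-! ### Leading terms of products of monomial quasisymmetric functions -/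

/-- The total order on compositions by length, and lexicographically for equal lengths. -/
def rank (α : Comp) : ℕ ×ₗ Comp := toLex (α.length, α)

theorem rank_le_rank {α β : Comp} :
    rank α ≤ rank β ↔ α.length < β.length ∨ α.length = β.length ∧ α ≤ β :=
  Prod.Lex.toLex_le_toLex

theorem rank_injective : Function.Injective rank := fun _ _ h =>
  congrArg (fun x => (ofLex x).2) h

/-- `M_β` is the leading term of `F`: all coefficients of `F` are natural numbers, the
coefficient of `M_β` is nonzero, and the other compositions that occur have the same size as `β`
and smaller rank. Natural coefficients prevent cancellation when such elements are multiplied. -/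
structure HasLeadingTerm (F : QSym R) (β : Comp) : Prop where
  natCast : ∀ α, ∃ n : ℕ, coeffLin R (packed α) F = n
  ne_zero : coeffLin R (packed β) F ≠ 0
  le : ∀ α, coeffLin R (packed α) F ≠ 0 → size α = size β ∧ rank α ≤ rank β

theorem IsFactorization.factorization_flatten {A : Type*} [LinearOrder A] {l : List (List A)}
    (h : IsFactorization l) : factorization l.flatten = l :=
  (isFactorization_factorization _).eq_of_flatten_eq h (flatten_factorization _)

theorem exists_add_shape_eq (α β : Comp) :
    ∃ b : ℕ →₀ ℕ, shape b = β ∧ shape (packed α + b) = α ++ β := by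
  let f : ℕ ↪o ℕ := OrderEmbedding.ofStrictMono (fun n => α.length + n)
    (fun a b hab => by simpa using hab)
  refine ⟨(packed β).embDomain f.toEmbedding, by rw [shape_embDomain, shape_packed], ?_⟩
  rw [shape_add, shape_embDomain, shape_packed, shape_packed]
  intro i hi j hj
  rw [support_packed] at hi
  rw [Finsupp.support_embDomain, support_packed] at hj
  simp only [Finset.mem_range, Finset.mem_map] at hi hj
  obtain ⟨k, -, rfl⟩ := hj
  have : f.toEmbedding k = α.length + k := rfl
  omega

theorem sum_ne_zero_of_natCast [CharZero R] {ι : Type*} {s : Finset ι} {f : ι → R}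
    (h : ∀ i ∈ s, ∃ n : ℕ, f i = n) {i : ι} (hi : i ∈ s) (h0 : f i ≠ 0) : ∑ i ∈ s, f i ≠ 0 := by
  choose! n hn using h
  rw [Finset.sum_congr rfl hn, ← Nat.cast_sum, Nat.cast_ne_zero, ← Nat.pos_iff_ne_zero]
  refine Finset.sum_pos' (fun _ _ => Nat.zero_le _) ⟨i, hi, Nat.pos_of_ne_zero fun h => h0 ?_⟩
  rw [hn i hi, h, Nat.cast_zero]

/-- Multiplication by `M_w` puts the Lyndon word `w` in front of the leading term, provided that
`w` is at least as large as all its Lyndon factors: only shuffles have maximal length, and the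
largest shuffle is the concatenation. -/
theorem HasLeadingTerm.M_mul [CharZero R] {w : Comp} {l : List Comp}
    (hl : IsFactorization (w :: l)) {F : QSym R} (hF : HasLeadingTerm F l.flatten) :
    HasLeadingTerm (M R w * F) (w ++ l.flatten) := by
  have hw := hl.2 w (by simp)
  have hl' : IsFactorization l :=
    ⟨(List.pairwise_cons.1 hl.1).2, fun v hv => hl.2 v (by simp [hv])⟩
  have hw' : IsFactorization [w] := ⟨by simp, by simpa using hw⟩
  have hterm : ∀ a b : ℕ →₀ ℕ, ∃ n : ℕ, coeffLin R a (M R w) * coeffLin R b F = n := by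
    intro a b
    obtain ⟨n, hn⟩ := hF.natCast (shape b)
    rw [coeffLin_packed_shape] at hn
    refine ⟨if shape a = w then n else 0, ?_⟩
    rw [coeffLin_M, hn]
    split_ifs <;> simp
  refine ⟨fun α => ?_, ?_, fun α h => ?_⟩
  · choose n hn using hterm
    refine ⟨∑ p ∈ Finset.HasAntidiagonal.antidiagonal (packed α), n p.1 p.2, ?_⟩
    rw [coeffLin_mul, Nat.cast_sum]
    exact Finset.sum_congr rfl fun p _ => hn _ _
  · obtain ⟨b, hb, hab⟩ := exists_add_shape_eq w l.flatten
    rw [← hab, coeffLin_packed_shape, coeffLin_mul]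
    refine sum_ne_zero_of_natCast (fun p _ => hterm p.1 p.2) (i := (packed w, b))
      (Finset.HasAntidiagonal.mem_antidiagonal.2 rfl) ?_
    rw [coeffLin_M, shape_packed, if_pos rfl, one_mul, ← coeffLin_packed_shape, hb]
    exact hF.ne_zero
  · rw [coeffLin_mul] at h
    obtain ⟨⟨a, b⟩, hp, hne⟩ := Finset.exists_ne_zero_of_sum_ne_zero h
    rw [Finset.HasAntidiagonal.mem_antidiagonal] at hp
    dsimp only at hp hne
    have ha : shape a = w := by
      by_contra hc
      rw [coeffLin_M, if_neg hc, zero_mul] at hne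
      exact hne rfl
    obtain ⟨hs, hr⟩ := hF.le (shape b)
      (by rw [coeffLin_packed_shape]; exact right_ne_zero_of_mul hne)
    have hα : α = shape (a + b) := by rw [hp, shape_packed]
    have hlen := length_shape_add_le a b
    rw [← hα, ha] at hlen
    refine ⟨?_, ?_⟩
    · rw [hα, size_shape, map_add, ← size_shape, ← size_shape, ha, hs, size_append]
    rw [rank_le_rank] at hr ⊢
    rw [List.length_append]
    by_cases hlt : α.length < w.length + l.flatten.length
    · exact Or.inl hlt
    obtain ⟨hbl, hbf⟩ : (shape b).length = l.flatten.length ∧ shape b ≤ l.flatten := by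
      rcases hr with hr | hr
      · omega
      · exact hr
    have hsh := shuffle_shape (disjoint_support_of_length_shape_add (a := a) (b := b)
      (by rw [← hα, ha]; omega))
    rw [← hα, ha] at hsh
    obtain ⟨t, ht, -, hle⟩ := hsh.exists_shuffle_le hbl
    -- `α` has maximal length, so it is a shuffle of `w` and `shape b`
    refine Or.inr ⟨by omega, (hle hbf).trans (ht.le_sortedFlatten.trans (le_of_eq ?_))⟩
    have h1 : factorization w = [w] := by simpa using hw'.factorization_flatten
    rw [h1, hl'.factorization_flatten, List.singleton_append, sortedFlatten_eq_flatten hl.1,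
      List.flatten_cons]

theorem IsFactorization.hasLeadingTerm [CharZero R] {l : List Comp} (hl : IsFactorization l) :
    HasLeadingTerm (l.map (M R)).prod l.flatten := by
  induction l with
  | nil =>
    rw [List.map_nil, List.prod_nil, List.flatten_nil, ← M_nil]
    refine ⟨fun α => ⟨if α = [] then 1 else 0, ?_⟩, ?_, fun α h => ?_⟩
    · rw [coeffLin_M, shape_packed]; split_ifs <;> simp
    · rw [coeffLin_M, shape_packed, if_pos rfl]; exact one_ne_zero
    · rw [coeffLin_M, shape_packed] at h
      have : α = [] := by by_contra hc; exact h (if_neg hc)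
      subst this
      exact ⟨rfl, le_rfl⟩
  | cons w l ih =>
    rw [List.map_cons, List.prod_cons, List.flatten_cons]
    exact (ih ⟨(List.pairwise_cons.1 hl.1).2, fun v hv => hl.2 v (by simp [hv])⟩).M_mul hl

end Coordinates

/-! ### The Lyndon monomial functions are free polynomial generators -/

section Freeness

/-- The nonincreasing sequence of Lyndon words given by a monomial in the variables `u_α`. -/
def lyndonList (s : Lyndon →₀ ℕ) : List Comp :=
  ((Finsupp.toMultiset s).map Subtype.val).sort (· ≥ ·)

theorem isFactorization_lyndonList (s : Lyndon →₀ ℕ) : IsFactorization (lyndonList s) := by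
  refine ⟨Multiset.pairwise_sort _ _, fun w hw => ?_⟩
  rw [lyndonList, Multiset.mem_sort, Multiset.mem_map] at hw
  obtain ⟨α, -, rfl⟩ := hw
  exact isLyndon_iff.1 α.2

theorem flatten_lyndonList_injective :
    Function.Injective fun s : Lyndon →₀ ℕ => (lyndonList s).flatten := by
  intro s t h
  have h1 := (isFactorization_lyndonList s).eq_of_flatten_eq (isFactorization_lyndonList t) h
  have h2 := congrArg (fun l : List Comp => (l : Multiset Comp)) h1
  simp only [lyndonList, Multiset.sort_eq] at h2
  simpa using congrArg Multiset.toFinsupp (Multiset.map_injective Subtype.val_injective h2)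

theorem exists_flatten_lyndonList_eq (β : Comp) : ∃ s, (lyndonList s).flatten = β := by
  have hf := isFactorization_factorization β
  let m : Multiset Lyndon := ((factorization β).attach.map
    fun w => (⟨w.1, isLyndon_iff.2 (hf.2 w.1 w.2)⟩ : Lyndon) : List Lyndon)
  refine ⟨Multiset.toFinsupp m, ?_⟩
  have h : lyndonList (Multiset.toFinsupp m) = factorization β := by
    refine List.Perm.eq_of_pairwise (le := (· ≥ ·)) (fun a b _ _ h1 h2 => le_antisymm h2 h1)
      (isFactorization_lyndonList _).1 hf.1 ?_
    rw [← Multiset.coe_eq_coe]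
    simpa [lyndonList, m, Function.comp_def] using List.mergeSort_perm _ _
  rw [h, flatten_factorization]

variable (K : Type*) [Field K]

theorem aeval_monomial_eq_prod (s : Lyndon →₀ ℕ) :
    MvPolynomial.aeval (fun α : Lyndon => M K α.1) (MvPolynomial.monomial s (1 : K)) =
      ((lyndonList s).map (M K)).prod := by
  rw [MvPolynomial.aeval_monomial, map_one, one_mul, ← Multiset.prod_coe, ← Multiset.map_coe,
    lyndonList, Multiset.sort_eq, Multiset.map_map, Finsupp.toMultiset_map,
    Finsupp.prod_toMultiset, Finsupp.prod_mapDomain_index (by simp) (by simp [pow_add])]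
  rfl

variable [CharZero K]

theorem aeval_lyndon_injective :
    Function.Injective (MvPolynomial.aeval (R := K) fun α : Lyndon => M K α.1) := by
  rw [injective_iff_map_eq_zero]
  intro p hp
  by_contra h0
  obtain ⟨s, hs, hmax⟩ := Finset.exists_max_image p.support
    (fun s => rank (lyndonList s).flatten) (MvPolynomial.support_nonempty.2 h0)
  have h1 := congrArg (coeffLin K (packed (lyndonList s).flatten)) hp
  rw [p.as_sum, map_sum, map_sum, map_zero, Finset.sum_eq_single_of_mem s hs] at h1
  · rw [← mul_one (p.coeff s), ← smul_eq_mul, ← MvPolynomial.smul_monomial, map_smul, map_smul,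
      aeval_monomial_eq_prod, smul_eq_mul] at h1
    exact mul_ne_zero (MvPolynomial.mem_support_iff.1 hs)
      (isFactorization_lyndonList s).hasLeadingTerm.ne_zero h1
  · intro t ht hts
    rw [← mul_one (p.coeff t), ← smul_eq_mul, ← MvPolynomial.smul_monomial, map_smul, map_smul,
      aeval_monomial_eq_prod, smul_eq_mul]
    by_contra hc
    have h2 := ((isFactorization_lyndonList t).hasLeadingTerm.le _ (right_ne_zero_of_mul hc)).2
    exact hts (flatten_lyndonList_injective (rank_injective (le_antisymm (hmax t ht) h2)))

/-- A composition of minimal rank for which this failed would be the leading term of a product of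
Lyndon generators, all other terms of which lie in the range. -/
theorem M_mem_range_aeval_lyndon (β : Comp) :
    M K β ∈ (MvPolynomial.aeval (R := K) fun α : Lyndon => M K α.1).range := by
  classical
  set S := (MvPolynomial.aeval (R := K) fun α : Lyndon => M K α.1).range
  by_contra hβ
  obtain ⟨α, hα, hmin⟩ := Finset.exists_min_image
    ((compsOf (size β)).filter fun α => M K α ∉ S) rank ⟨β, by simp [hβ]⟩
  rw [Finset.mem_filter, mem_compsOf] at hα
  obtain ⟨s, hs⟩ := exists_flatten_lyndonList_eq α
  have hL := (isFactorization_lyndonList s).hasLeadingTerm (R := K)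
  rw [← aeval_monomial_eq_prod, hs] at hL
  set F := MvPolynomial.aeval (fun α : Lyndon => M K α.1) (MvPolynomial.monomial s (1 : K))
  have hF : F ∈ S := ⟨_, rfl⟩
  have hsum := (monomialBasis K).linearCombination_repr F
  rw [Finsupp.linearCombination_apply, Finsupp.sum] at hsum
  simp only [monomialBasis_repr, monomialBasis_apply] at hsum
  have hmem : α ∈ ((monomialBasis K).repr F).support := by
    rw [Finsupp.mem_support_iff, monomialBasis_repr]; exact hL.ne_zero
  rw [← Finset.add_sum_erase _ _ hmem] at hsum
  have hrest : ∑ γ ∈ ((monomialBasis K).repr F).support.erase α,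
      coeffLin K (packed γ) F • M K γ ∈ S := by
    refine Subalgebra.sum_mem _ fun γ hγ => Subalgebra.smul_mem _ ?_ _
    rw [Finset.mem_erase, Finsupp.mem_support_iff, monomialBasis_repr] at hγ
    obtain ⟨h1, h2⟩ := hL.le γ hγ.2
    by_contra hc
    refine hγ.1 (rank_injective (le_antisymm h2 (hmin γ ?_)))
    rw [Finset.mem_filter, mem_compsOf]
    exact ⟨h1.trans hα.1, hc⟩
  have h3 : coeffLin K (packed α) F • M K α ∈ S := by
    rw [eq_sub_of_add_eq hsum]
    exact Subalgebra.sub_mem _ hF hrest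
  refine hα.2 ?_
  rw [← inv_smul_smul₀ hL.ne_zero (M K α)]
  exact Subalgebra.smul_mem _ h3 _

theorem aeval_lyndon_bijective :
    Function.Bijective (MvPolynomial.aeval (R := K) fun α : Lyndon => M K α.1) := by
  refine ⟨aeval_lyndon_injective K, fun F => ?_⟩
  have h : F ∈ Submodule.span K (Set.range (M K)) := span_M K trivial
  have hle : Submodule.span K (Set.range (M K)) ≤ Subalgebra.toSubmodule
      (MvPolynomial.aeval (R := K) fun α : Lyndon => M K α.1).range := by
    rw [Submodule.span_le]
    rintro _ ⟨β, rfl⟩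
    exact M_mem_range_aeval_lyndon K β
  exact hle h

end Freeness

/-! ### Characters and their homogeneous components -/

section Characters

open Coalgebra

variable {R : Type*} [CommRing R]

theorem ext_bilinear {N : Type*} [AddCommMonoid N] [Module R N]
    {f g : QSym R →ₗ[R] QSym R →ₗ[R] N} (h : ∀ α β, f (M R α) (M R β) = g (M R α) (M R β)) :
    f = g :=
  (monomialBasis R).ext fun α => (monomialBasis R).ext fun β => by
    simpa only [monomialBasis_apply] using h α β

/-- The component of degree `c` of a character: it agrees with `χ` in degree `c` and vanishes in
the other degrees. -/
def component (χ : QSym R →ₐ[R] R) (c : ℕ) : QSym R →ₗ[R] R :=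
  (monomialBasis R).constr R fun β => if size β = c then χ (M R β) else 0

theorem component_M (χ : QSym R →ₐ[R] R) (c : ℕ) (β : Comp) :
    component χ c (M R β) = if size β = c then χ (M R β) else 0 := by
  conv_lhs => rw [← monomialBasis_apply]
  exact Module.Basis.constr_basis _ _ _ _

theorem component_of_mem_homogeneous (χ : QSym R →ₐ[R] R) (c : ℕ) {n : ℕ} {F : QSym R}
    (hF : F ∈ homogeneous R n) : component χ c F = if n = c then χ F else 0 := by
  induction hF using Submodule.span_induction with
  | mem x hx =>
    obtain ⟨β, rfl, rfl⟩ := hx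
    exact component_M χ c β
  | zero => simp
  | add x y _ _ hx hy => rw [map_add, hx, hy, map_add]; split_ifs <;> simp
  | smul r x _ hx => rw [map_smul, hx, map_smul]; split_ifs <;> simp

theorem component_zero (χ : QSym R →ₐ[R] R) : component χ 0 = counit := by
  refine (monomialBasis R).ext fun β => ?_
  rw [monomialBasis_apply, component_M, counit_M]
  cases β with
  | nil => simp [M_nil]
  | cons b β => simp

theorem component_mul (χ : QSym R →ₐ[R] R) (c : ℕ) (F G : QSym R) :
    component χ c (F * G) =
      ∑ p ∈ Finset.HasAntidiagonal.antidiagonal c, component χ p.1 F * component χ p.2 G := by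
  have h : (LinearMap.mul R (QSym R)).compr₂ (component χ c) =
      ∑ p ∈ Finset.HasAntidiagonal.antidiagonal c,
        (LinearMap.mul R R).compl₁₂ (component χ p.1) (component χ p.2) := by
    refine ext_bilinear fun α β => ?_
    simp only [LinearMap.compr₂_apply, LinearMap.mul_apply', LinearMap.sum_apply,
      LinearMap.compl₁₂_apply, component_M]
    rw [component_of_mem_homogeneous χ c
      (mul_mem_homogeneous (M_mem_homogeneous α) (M_mem_homogeneous β)), map_mul]
    by_cases hc : size α + size β = c
    · rw [if_pos hc, Finset.sum_eq_single_of_mem (size α, size β) (by simpa using hc)]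
      · simp
      · rintro ⟨a, b⟩ _ hne
        by_cases ha : size α = a
        · rw [if_neg (c := size β = b), mul_zero]
          rintro rfl
          exact hne (by simp [ha])
        · rw [if_neg ha, zero_mul]
    · rw [if_neg hc]
      refine (Finset.sum_eq_zero ?_).symm
      rintro ⟨a, b⟩ hab
      rw [Finset.HasAntidiagonal.mem_antidiagonal] at hab
      by_cases ha : size α = a
      · rw [if_neg (c := size β = b), mul_zero]
        rintro rfl
        exact hc (by rw [ha]; exact hab)
      · rw [if_neg ha, zero_mul]
  simpa using LinearMap.congr_fun (LinearMap.congr_fun h F) G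

/-- The operator `(χ_c ⊗ id) ∘ Δ`, which strips off a prefix of size `c` with weight given by the
character `χ`. -/
def strip (χ : QSym R →ₐ[R] R) (c : ℕ) : QSym R →ₗ[R] QSym R :=
  TensorProduct.lid R (QSym R) ∘ₗ (component χ c).rTensor (QSym R) ∘ₗ comul

theorem strip_M (χ : QSym R →ₐ[R] R) (c : ℕ) (β : Comp) :
    strip χ c (M R β) = ∑ i ∈ Finset.range (β.length + 1),
      component χ c (M R (β.take i)) • M R (β.drop i) := by
  simp [strip, comul_M]

theorem strip_zero (χ : QSym R →ₐ[R] R) : strip χ 0 = LinearMap.id := by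
  ext1 F
  simp [strip, component_zero]

/-- The operators attached to a character satisfy the Leibniz rule of a family of divided powers
of a derivation. -/
theorem strip_mul (χ : QSym R →ₐ[R] R) (c : ℕ) (F G : QSym R) :
    strip χ c (F * G) =
      ∑ p ∈ Finset.HasAntidiagonal.antidiagonal c, strip χ p.1 F * strip χ p.2 G := by
  have key : ∀ X Y : QSym R ⊗[R] QSym R,
      TensorProduct.lid R (QSym R) ((component χ c).rTensor (QSym R) (X * Y)) =
      ∑ p ∈ Finset.HasAntidiagonal.antidiagonal c,
        TensorProduct.lid R (QSym R) ((component χ p.1).rTensor (QSym R) X) *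
        TensorProduct.lid R (QSym R) ((component χ p.2).rTensor (QSym R) Y) := by
    intro X Y
    induction X using TensorProduct.induction_on with
    | zero => simp
    | add X X' hX hX' => simp only [add_mul, map_add, hX, hX', Finset.sum_add_distrib]
    | tmul F G =>
      induction Y using TensorProduct.induction_on with
      | zero => simp
      | add Y Y' hY hY' => simp only [mul_add, map_add, hY, hY', Finset.sum_add_distrib]
      | tmul F' G' =>
        simp only [Algebra.TensorProduct.tmul_mul_tmul, LinearMap.rTensor_tmul,
          TensorProduct.lid_tmul, component_mul, Finset.sum_smul, smul_mul_smul_comm]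
  simp only [strip, LinearMap.comp_apply, LinearEquiv.coe_coe, comul_mul_qsym, key]

/-- The functional `(χ_{a₁} ⊗ ⋯ ⊗ χ_{aₖ}) ∘ Δ^{(k)}` attached to a character `χ` and a composition
`(a₁, …, aₖ)`, as a product in the convolution algebra. -/
def charFunctional (χ : QSym R →ₐ[R] R) (α : Comp) : QSym R →ₗ[R] R :=
  (α.map fun c : ℕ+ => WithConv.toConv (component χ (c : ℕ))).prod.ofConv

theorem charFunctional_nil (χ : QSym R →ₐ[R] R) : charFunctional χ [] = counit := by
  ext F
  simp [charFunctional, LinearMap.convOne_def]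

theorem charFunctional_append (χ : QSym R →ₐ[R] R) (α β : Comp) (F : QSym R) :
    charFunctional χ (α ++ β) F =
      LinearMap.mul' R R
        (TensorProduct.map (charFunctional χ α) (charFunctional χ β) (comul F)) := by
  simp [charFunctional, LinearMap.convMul_def]

theorem charFunctional_cons (χ : QSym R →ₐ[R] R) (c : ℕ+) (α : Comp) (F : QSym R) :
    charFunctional χ (c :: α) F = charFunctional χ α (strip χ c F) := by
  have h1 : charFunctional χ [c] = component χ c := by simp [charFunctional]
  have h2 : LinearMap.mul' R R ∘ₗ TensorProduct.map (component χ c) (charFunctional χ α) =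
      charFunctional χ α ∘ₗ TensorProduct.lid R (QSym R) ∘ₗ
        (component χ c).rTensor (QSym R) := by
    ext; simp
  rw [← List.singleton_append, charFunctional_append, h1]
  exact LinearMap.congr_fun h2 (comul F)

theorem charFunctional_cons_M (χ : QSym R →ₐ[R] R) (c : ℕ+) (α β : Comp) :
    charFunctional χ (c :: α) (M R β) = ∑ i ∈ Finset.range (β.length + 1),
      component χ c (M R (β.take i)) * charFunctional χ α (M R (β.drop i)) := by
  simp [charFunctional_cons, strip_M]

theorem eq_of_size_take_eq {β : Comp} {i j : ℕ} (hi : i ≤ β.length) (hj : j ≤ β.length)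
    (h : size (β.take i) = size (β.take j)) : i = j := by
  have key : ∀ i j : ℕ, i < j → j ≤ β.length → size (β.take i) ≠ size (β.take j) := by
    intro i j hij hj he
    have h1 : β.take j = β.take i ++ (β.take j).drop i := by
      conv_lhs => rw [← List.take_append_drop i (β.take j), List.take_take, min_eq_left hij.le]
    rw [h1, size_append] at he
    have h2 : (β.take j).drop i ≠ [] := by
      rw [Ne, List.drop_eq_nil_iff, List.length_take]; omega
    obtain ⟨b, l, hbl⟩ := List.exists_cons_of_ne_nil h2
    rw [hbl, size_cons] at he
    have := b.pos
    omega
  rcases lt_trichotomy i j with hij | hij | hij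
  · exact absurd h (key i j hij hj)
  · exact hij
  · exact absurd h.symm (key j i hij hi)

theorem charFunctional_M_of_cuts (χ : QSym R →ₐ[R] R) {L : List Comp} {β α : Comp}
    (h : Cuts L β α) : charFunctional χ α (M R β) = (L.map fun γ => χ (M R γ)).prod := by
  induction α generalizing L β with
  | nil =>
    obtain rfl : L = [] := by simpa using h.2
    obtain rfl : [] = β := h.1
    simp [charFunctional_nil, counit_M]
  | cons c α ih =>
    cases L with
    | nil => simp [Cuts] at h
    | cons γ L =>
      obtain ⟨rfl, h2⟩ := h
      simp only [List.map_cons, List.cons.injEq] at h2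
      have hlen : γ.length ≤ (γ ++ L.flatten).length := by simp
      rw [charFunctional_cons_M, List.flatten_cons, Finset.sum_eq_single_of_mem γ.length
        (Finset.mem_range.2 (Nat.lt_succ_of_le hlen))]
      · rw [List.take_left, List.drop_left, component_M, if_pos h2.1, ih ⟨rfl, h2.2⟩,
          List.map_cons, List.prod_cons]
      · intro i hi hne
        rw [component_M, if_neg, zero_mul]
        intro hs
        refine hne (eq_of_size_take_eq (Nat.lt_succ_iff.1 (Finset.mem_range.1 hi)) hlen ?_)
        rw [hs, List.take_left, h2.1]

theorem refines_of_charFunctional_M_ne_zero (χ : QSym R →ₐ[R] R) {β α : Comp}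
    (h : charFunctional χ α (M R β) ≠ 0) : Refines β α := by
  induction α generalizing β with
  | nil =>
    rw [charFunctional_nil, counit_M] at h
    have : β = [] := by by_contra hc; exact h (if_neg hc)
    exact ⟨[], this.symm, rfl⟩
  | cons c α ih =>
    rw [charFunctional_cons_M] at h
    obtain ⟨i, -, hne⟩ := Finset.exists_ne_zero_of_sum_ne_zero h
    obtain ⟨L, hL1, hL2⟩ := ih (right_ne_zero_of_mul hne)
    refine ⟨β.take i :: L, by rw [List.flatten_cons, hL1, List.take_append_drop], ?_⟩
    rw [List.map_cons, hL2, List.map_cons]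
    congr 1
    by_contra hc
    exact left_ne_zero_of_mul hne (by rw [component_M, if_neg hc])

theorem Refines.size_eq {β α : Comp} (h : Refines β α) : size α = size β := by
  obtain ⟨L, rfl, h2⟩ := h
  rw [size_flatten, h2, size]

/-! ### The canonical character -/

theorem coeffLin_single_mul (n : ℕ) (F G : QSym R) :
    coeffLin R (Finsupp.single 0 n) (F * G) = ∑ p ∈ Finset.HasAntidiagonal.antidiagonal n,
      coeffLin R (Finsupp.single 0 p.1) F * coeffLin R (Finsupp.single 0 p.2) G := by
  rw [coeffLin_mul, Finsupp.antidiagonal_single, Finset.sum_map]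
  rfl

theorem shape_single (n : ℕ) (hn : 0 < n) : shape (Finsupp.single 0 n) = [n.toPNat'] := by
  have h : (Finsupp.single 0 n : ℕ →₀ ℕ).support = {0} := by
    ext i
    simp only [Finsupp.mem_support_iff, Finsupp.single_apply, Finset.mem_singleton]
    split_ifs <;> omega
  rw [shape, h]
  simp

variable (R) in
/-- The canonical character `ζ`, the evaluation at `x₀ = 1`, `xᵢ = 0` for `i > 0`. -/
def canonicalCharacter : QSym R →ₐ[R] R :=
  AlgHom.ofLinearMap ((monomialBasis R).constr R fun β => if β.length ≤ 1 then 1 else 0)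
    (by rw [← M_nil, ← monomialBasis_apply, Module.Basis.constr_basis]; simp)
    (by
      set f : QSym R →ₗ[R] R :=
        (monomialBasis R).constr R fun β => if β.length ≤ 1 then 1 else 0 with hf
      -- in degree `n`, `ζ` is the coefficient of `x₀ ^ n`, which is multiplicative
      have hfM : ∀ β, f (M R β) = coeffLin R (Finsupp.single 0 (size β)) (M R β) := by
        intro β
        rw [hf, ← monomialBasis_apply, Module.Basis.constr_basis, monomialBasis_apply, coeffLin_M]
        match β with
        | [] => simp [shape]
        | [b] => simp [shape_single _ b.pos]
        | b :: b' :: β =>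
          rw [shape_single _ (by have := b.pos; simp only [size_cons]; omega)]
          simp
      have hfh : ∀ n, ∀ F ∈ homogeneous R n, f F = coeffLin R (Finsupp.single 0 n) F := by
        intro n F hF
        induction hF using Submodule.span_induction with
        | mem x hx => obtain ⟨β, rfl, rfl⟩ := hx; exact hfM β
        | zero => simp
        | add x y _ _ hx hy => rw [map_add, hx, hy, map_add]
        | smul r x _ hx => rw [map_smul, hx, map_smul]
      have h : (LinearMap.mul R (QSym R)).compr₂ f = (LinearMap.mul R R).compl₁₂ f f := by
        refine ext_bilinear fun α β => ?_
        simp only [LinearMap.compr₂_apply, LinearMap.mul_apply', LinearMap.compl₁₂_apply]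
        rw [hfh _ _ (mul_mem_homogeneous (M_mem_homogeneous α) (M_mem_homogeneous β)),
          coeffLin_single_mul, Finset.sum_eq_single_of_mem (size α, size β) (by simp), hfM, hfM]
        rintro ⟨a, b⟩ hab hne
        rw [Finset.HasAntidiagonal.mem_antidiagonal] at hab
        rw [coeffLin_M, if_neg, zero_mul]
        intro h
        have := congrArg size h
        rw [size_shape, Finsupp.degree_single] at this
        dsimp only at this hab
        exact hne (by rw [Prod.mk.injEq]; omega)
      intro F G
      simpa using LinearMap.congr_fun (LinearMap.congr_fun h F) G)

theorem canonicalCharacter_M (β : Comp) :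
    canonicalCharacter R (M R β) = if β.length ≤ 1 then 1 else 0 := by
  rw [← monomialBasis_apply, canonicalCharacter, AlgHom.ofLinearMap_apply,
    Module.Basis.constr_basis]

/-- The functionals of the canonical character are the coordinates in the monomial basis: since `ζ`
vanishes on the `M_γ` with more than one part, `strip ζ c` removes a single first part `c`. -/
theorem charFunctional_canonicalCharacter (α : Comp) :
    charFunctional (canonicalCharacter R) α = coeffLin R (packed α) := by
  refine (monomialBasis R).ext fun β => ?_
  rw [monomialBasis_apply, coeffLin_M, shape_packed]
  induction α generalizing β with
  | nil => rw [charFunctional_nil, counit_M]; simp only [eq_comm]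
  | cons c α ih =>
    rw [charFunctional_cons_M]
    cases β with
    | nil =>
      rw [if_neg (by simp)]
      simp [component_M, c.ne_zero.symm]
    | cons b β =>
      rw [Finset.sum_eq_single_of_mem 1 (by simp)]
      · simp only [List.take_succ_cons, List.take_zero, List.drop_succ_cons, List.drop_zero, ih,
          component_M, canonicalCharacter_M, size_cons, size_nil, add_zero, PNat.coe_inj,
          List.length_singleton, le_refl, if_true, List.cons.injEq]
        by_cases h1 : c = b
        · by_cases h2 : α = β <;> simp [h1, h2]
        · simp [h1, Ne.symm h1]
      · intro i hi hne
        rw [Finset.mem_range] at hi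
        rw [component_M]
        split_ifs with hs
        · rw [canonicalCharacter_M, if_neg, zero_mul]
          intro hl
          rw [List.length_take] at hl
          have : i = 0 := by omega
          subst this
          simp [c.ne_zero.symm] at hs
        · rw [zero_mul]

/-! ### The endomorphism attached to a character -/

/-- The endomorphism of `QSym` attached to a character `χ`: the coefficient of `M_α` in the image
of `F` is `(χ_{a₁} ⊗ ⋯ ⊗ χ_{aₖ}) (Δ^{(k)} F)`. -/
def ofCharacter (χ : QSym R →ₐ[R] R) : QSym R →ₗ[R] QSym R :=
  (monomialBasis R).constr R fun β =>
    ∑ α ∈ compsOf (size β), charFunctional χ α (M R β) • M R α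

theorem ofCharacter_M (χ : QSym R →ₐ[R] R) (β : Comp) : ofCharacter χ (M R β) =
    ∑ α ∈ compsOf (size β), charFunctional χ α (M R β) • M R α := by
  conv_lhs => rw [← monomialBasis_apply]
  exact Module.Basis.constr_basis _ _ _ _

theorem coeffLin_ofCharacter (χ : QSym R →ₐ[R] R) (α : Comp) (F : QSym R) :
    coeffLin R (packed α) (ofCharacter χ F) = charFunctional χ α F := by
  have h : coeffLin R (packed α) ∘ₗ ofCharacter χ = charFunctional χ α := by
    refine (monomialBasis R).ext fun β => ?_
    rw [monomialBasis_apply, LinearMap.comp_apply, ofCharacter_M, map_sum]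
    simp only [map_smul, coeffLin_M, shape_packed, smul_eq_mul, mul_ite, mul_one, mul_zero,
      Finset.sum_ite_eq, mem_compsOf]
    split_ifs with hs
    · rfl
    · by_contra hc
      exact hs (refines_of_charFunctional_M_ne_zero χ (Ne.symm hc)).size_eq
  exact LinearMap.congr_fun h F

theorem ofCharacter_mem_homogeneous (χ : QSym R →ₐ[R] R) {n : ℕ} {F : QSym R}
    (hF : F ∈ homogeneous R n) : ofCharacter χ F ∈ homogeneous R n := by
  induction hF using Submodule.span_induction with
  | mem x hx =>
    obtain ⟨β, rfl, rfl⟩ := hx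
    rw [ofCharacter_M]
    refine Submodule.sum_mem _ fun α hα => Submodule.smul_mem _ _ ?_
    rw [mem_compsOf] at hα
    exact hα ▸ M_mem_homogeneous α
  | zero => simp
  | add x y _ _ hx hy => rw [map_add]; exact Submodule.add_mem _ hx hy
  | smul r x _ hx => rw [map_smul]; exact Submodule.smul_mem _ _ hx

theorem coeffLin_packed_nil (F : QSym R) : coeffLin R (packed []) F = counit (R := R) F := by
  rw [← charFunctional_canonicalCharacter, charFunctional_nil]

theorem coeffLin_packed_cons (c : ℕ+) (α : Comp) (F : QSym R) :
    coeffLin R (packed (c :: α)) F =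
      coeffLin R (packed α) (strip (canonicalCharacter R) c F) := by
  rw [← charFunctional_canonicalCharacter, charFunctional_cons,
    charFunctional_canonicalCharacter]

/-- In positive degree this is the definition of `charFunctional` on a nonempty composition, and
in degree `0` both operators are the identity. -/
theorem strip_ofCharacter (χ : QSym R →ₐ[R] R) (c : ℕ) (F : QSym R) :
    strip (canonicalCharacter R) c (ofCharacter χ F) = ofCharacter χ (strip χ c F) := by
  rcases Nat.eq_zero_or_pos c with rfl | hc
  · simp [strip_zero]
  · refine ext_coeffLin_packed fun α => ?_
    obtain ⟨c, rfl⟩ : ∃ c' : ℕ+, (c' : ℕ) = c := ⟨⟨c, hc⟩, rfl⟩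
    rw [← coeffLin_packed_cons, coeffLin_ofCharacter, coeffLin_ofCharacter, charFunctional_cons]

theorem ofCharacter_mul (χ : QSym R →ₐ[R] R) (F G : QSym R) :
    ofCharacter χ (F * G) = ofCharacter χ F * ofCharacter χ G := by
  refine ext_coeffLin_packed fun α => ?_
  induction α generalizing F G with
  | nil =>
    simp only [coeffLin_ofCharacter, coeffLin_packed_nil, charFunctional_nil,
      Bialgebra.counit_mul]
    simp only [← coeffLin_packed_nil, coeffLin_ofCharacter, charFunctional_nil]
  | cons c α ih =>
    simp only [coeffLin_packed_cons, strip_ofCharacter, strip_mul, map_sum, ih]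

theorem ofCharacter_one (χ : QSym R →ₐ[R] R) : ofCharacter χ 1 = 1 := by
  have h : compsOf 0 = {[]} := by
    ext α
    rw [mem_compsOf, Finset.mem_singleton]
    cases α <;> simp
  rw [← M_nil, ofCharacter_M, size_nil, h, Finset.sum_singleton, charFunctional_nil, counit_M,
    if_pos rfl, one_smul]

theorem ext_coeffTensor_packed {X Y : QSym R ⊗[R] QSym R}
    (h : ∀ α β, coeffTensor R (packed α) (packed β) X = coeffTensor R (packed α) (packed β) Y) :
    X = Y := by
  refine ((monomialBasis R).tensorProduct (monomialBasis R)).ext_elem ?_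
  rintro ⟨α, β⟩
  have key : ((monomialBasis R).tensorProduct (monomialBasis R)).coord (α, β) =
      coeffTensor R (packed α) (packed β) := by
    ext F G
    simp [monomialBasis_repr, mul_comm]
  have := h α β
  rwa [← key] at this

theorem coeffTensor_packed_comul (α β : Comp) (F : QSym R) :
    coeffTensor R (packed α) (packed β) (comul F) = coeffLin R (packed (α ++ β)) F := by
  rw [← charFunctional_canonicalCharacter, charFunctional_append,
    charFunctional_canonicalCharacter, charFunctional_canonicalCharacter]
  rfl

theorem map_ofCharacter_comul (χ : QSym R →ₐ[R] R) (F : QSym R) :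
    TensorProduct.map (ofCharacter χ) (ofCharacter χ) (comul F) = comul (ofCharacter χ F) := by
  refine ext_coeffTensor_packed fun α β => ?_
  rw [coeffTensor_packed_comul, coeffLin_ofCharacter, charFunctional_append]
  have h : ∀ γ, coeffLin R (packed γ) ∘ₗ ofCharacter χ = charFunctional χ γ :=
    fun γ => LinearMap.ext fun G => coeffLin_ofCharacter χ γ G
  rw [coeffTensor, LinearMap.comp_apply, ← LinearMap.comp_apply (TensorProduct.map _ _),
    ← TensorProduct.map_comp, h, h]

theorem isGradedHopfEnd_ofCharacter (χ : QSym R →ₐ[R] R) : IsGradedHopfEnd (ofCharacter χ) := by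
  refine ⟨⟨BialgHom.ofAlgHom
    (AlgHom.ofLinearMap (ofCharacter χ) (ofCharacter_one χ) (ofCharacter_mul χ)) ?_ ?_, ?_⟩,
    fun n F hF => ofCharacter_mem_homogeneous χ hF⟩
  · refine AlgHom.ext fun F => ?_
    change counit (R := R) (ofCharacter χ F) = counit (R := R) F
    rw [← coeffLin_packed_nil, coeffLin_ofCharacter, charFunctional_nil]
  · refine AlgHom.ext fun F => ?_
    exact map_ofCharacter_comul χ F
  · intro F
    rfl

/-- Every graded Hopf algebra endomorphism `Ψ` comes from a character, namely from `ζ ∘ Ψ`. -/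
theorem IsGradedHopfEnd.exists_eq_ofCharacter {Φ : QSym R →ₗ[R] QSym R}
    (h : IsGradedHopfEnd Φ) : ∃ χ : QSym R →ₐ[R] R, Φ = ofCharacter χ := by
  obtain ⟨⟨Ψ, hΨ⟩, hgr⟩ := h
  obtain rfl : (Ψ : QSym R →ₗ[R] QSym R) = Φ := LinearMap.ext hΨ
  set χ : QSym R →ₐ[R] R := (canonicalCharacter R).comp (Ψ : QSym R →ₐ[R] QSym R)
  have hcomp : ∀ c, component (canonicalCharacter R) c ∘ₗ (Ψ : QSym R →ₗ[R] QSym R) =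
      component χ c := by
    intro c
    refine (monomialBasis R).ext fun β => ?_
    rw [monomialBasis_apply, LinearMap.comp_apply, component_M,
      component_of_mem_homogeneous _ c (hgr _ _ (M_mem_homogeneous β))]
    rfl
  have hstrip : ∀ c F, strip (canonicalCharacter R) c (Ψ F) = Ψ (strip χ c F) := by
    intro c F
    have h1 : comul (R := R) (Ψ F) = TensorProduct.map (Ψ : QSym R →ₗ[R] QSym R)
      (Ψ : QSym R →ₗ[R] QSym R) (comul F) := (CoalgHomClass.map_comp_comul_apply Ψ F).symm
    have h2 : (TensorProduct.lid R (QSym R) : _ →ₗ[R] _) ∘ₗ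
        (component (canonicalCharacter R) c).rTensor (QSym R) ∘ₗ
          TensorProduct.map (Ψ : QSym R →ₗ[R] QSym R) (Ψ : QSym R →ₗ[R] QSym R) =
        (Ψ : QSym R →ₗ[R] QSym R) ∘ₗ (TensorProduct.lid R (QSym R) : _ →ₗ[R] _) ∘ₗ
          (component χ c).rTensor (QSym R) := by
      rw [← hcomp]
      refine TensorProduct.ext' fun F G => ?_
      simp
    simp only [strip, LinearMap.comp_apply, LinearEquiv.coe_coe, h1]
    exact LinearMap.congr_fun h2 (comul F)
  refine ⟨χ, LinearMap.ext fun F => ext_coeffLin_packed fun α => ?_⟩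
  rw [coeffLin_ofCharacter]
  change coeffLin R (packed α) (Ψ F) = _
  induction α generalizing F with
  | nil => rw [coeffLin_packed_nil, charFunctional_nil, CoalgHomClass.counit_comp_apply]
  | cons c α ih => rw [coeffLin_packed_cons, hstrip, ih, charFunctional_cons]

end Characters

/-! ### Lyndon expansions and characters -/

section Expansion

theorem isLyndonExpansion_lyndonExpansion (β : Comp) :
    IsLyndonExpansion β (lyndonExpansion β) :=
  Classical.epsilon_spec ((aeval_lyndon_bijective ℚ).2 (M ℚ β))

variable {K : Type*} [Field K] [CharZero K]

theorem map_monomialSeries {R S : Type*} [CommRing R] [CommRing S] (φ : R →+* S) (α : Comp) :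
    MvPowerSeries.map φ (monomialSeries R α) = monomialSeries S α := by
  ext d
  rw [MvPowerSeries.coeff_map, coeff_monomialSeries, coeff_monomialSeries]
  split_ifs <;> simp

/-- Lyndon expansions, defined over `ℚ`, are valid over every field of characteristic `0`. -/
theorem aeval_lyndonExpansion (β : Comp) :
    MvPolynomial.aeval (fun α : Lyndon => M K α.1)
      (MvPolynomial.map (algebraMap ℚ K) (lyndonExpansion β)) = M K β := by
  have h : ∀ p : MvPolynomial Lyndon ℚ,
      (MvPolynomial.aeval (fun α : Lyndon => M K α.1)
        (MvPolynomial.map (algebraMap ℚ K) p) : QSym K).1 =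
      MvPowerSeries.map (algebraMap ℚ K)
        (MvPolynomial.aeval (fun α : Lyndon => M ℚ α.1) p : QSym ℚ).1 := by
    intro p
    induction p using MvPolynomial.induction_on with
    | C a =>
      simp only [MvPolynomial.map_C, MvPolynomial.aeval_C]
      change algebraMap K (MvPowerSeries ℕ K) _ =
        MvPowerSeries.map (algebraMap ℚ K) (algebraMap ℚ (MvPowerSeries ℕ ℚ) a)
      simp [MvPowerSeries.algebraMap_apply]
    | add p q hp hq => simp only [map_add, AddMemClass.coe_add, hp, hq]
    | mul_X p α hp =>
      simp only [map_mul, MvPolynomial.map_X, MvPolynomial.aeval_X, MulMemClass.coe_mul, hp]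
      congr 1
      exact (map_monomialSeries _ _).symm
  refine Subtype.ext ((h _).trans ?_)
  rw [isLyndonExpansion_lyndonExpansion β]
  exact map_monomialSeries _ _

theorem character_M_eq_aeval (χ : QSym K →ₐ[K] K) (β : Comp) :
    χ (M K β) = MvPolynomial.aeval (fun α : Lyndon => χ (M K α.1)) (lyndonExpansion β) := by
  rw [← aeval_lyndonExpansion (K := K) β, ← AlgHom.comp_apply, MvPolynomial.comp_aeval,
    MvPolynomial.aeval_map_algebraMap]

/-- By freeness, the values of a character on the Lyndon generators are arbitrary. -/
theorem exists_character (u : Lyndon → K) :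
    ∃ χ : QSym K →ₐ[K] K, ∀ α : Lyndon, χ (M K α.1) = u α := by
  let e := AlgEquiv.ofBijective _ (aeval_lyndon_bijective K)
  refine ⟨(MvPolynomial.aeval u).comp (e.symm : QSym K →ₐ[K] MvPolynomial Lyndon K),
    fun α => ?_⟩
  have : e.symm (M K α.1) = MvPolynomial.X α := by
    rw [AlgEquiv.symm_apply_eq]
    simp [e]
  simp [this]

open Classical in
theorem ofCharacter_M_eq_sum_entry (χ : QSym K →ₐ[K] K) (β : Comp) :
    ofCharacter χ (M K β) = ∑ α ∈ compsOf (size β) with Refines β α,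
      MvPolynomial.aeval (fun α : Lyndon => χ (M K α.1)) (entry β α) • M K α := by
  rw [ofCharacter_M, Finset.sum_filter]
  refine Finset.sum_congr rfl fun α _ => ?_
  split_ifs with h
  · obtain ⟨L, hL⟩ := h
    rw [charFunctional_M_of_cuts χ hL, entry_of_cuts hL, map_list_prod, List.map_map]
    congr 3
    funext γ
    exact character_M_eq_aeval χ γ
  · rw [not_imp_comm.1 (refines_of_charFunctional_M_ne_zero χ) h, zero_smul]

end Expansion

end QuasiSym

end

open QuasiSym in
open Classical in
theorem theorem5 (K : Type*) [Field K] [CharZero K] :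
    (∀ β : Comp, ∃! p : MvPolynomial Lyndon ℚ, IsLyndonExpansion β p) ∧
    (∀ u : Lyndon → K, ∃ Φ : QSym K →ₗ[K] QSym K,
      (∀ n : ℕ, ∀ β ∈ compsOf n,
        Φ (M K β) = ∑ α ∈ compsOf n with Refines β α,
          MvPolynomial.aeval u (entry β α) • M K α) ∧
      IsGradedHopfEnd Φ) ∧
    (∀ Φ : QSym K →ₗ[K] QSym K, IsGradedHopfEnd Φ →
      ∃ u : Lyndon → K, ∀ n : ℕ, ∀ β ∈ compsOf n,
        Φ (M K β) = ∑ α ∈ compsOf n with Refines β α,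
          MvPolynomial.aeval u (entry β α) • M K α) := by
  refine ⟨fun β => (aeval_lyndon_bijective ℚ).existsUnique (M ℚ β), fun u => ?_, fun Φ hΦ => ?_⟩
  · obtain ⟨χ, hχ⟩ := exists_character u
    obtain rfl : (fun α : Lyndon => χ (M K α.1)) = u := funext hχ
    refine ⟨ofCharacter χ, fun n β hβ => ?_, isGradedHopfEnd_ofCharacter χ⟩
    rw [mem_compsOf] at hβ
    subst hβ
    exact ofCharacter_M_eq_sum_entry χ β
  · obtain ⟨χ, rfl⟩ := hΦ.exists_eq_ofCharacter
    refine ⟨fun α => χ (M K α.1), fun n β hβ => ?_⟩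
    rw [mem_compsOf] at hβ
    subst hβ
    exact ofCharacter_M_eq_sum_entry χ β
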